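/- Let $\lambda,\mathcal U,\rho,\theta>0$, $\sigma^2\ge 0$, $\eta>2$, let $n_Z\ge 1$ be an integer, put $c=3.575$ and $\tilde{\mathcal U}=\mathcal U/n_Z$ (the intensity of the devices transmitting on one given Zadoff–Chu sequence when every one of the $\mathcal U$ devices per unit area transmits in each slot on one of $n_Z$ sequences), and consider one slot of the baseline scheme in the following approximate model. A test device transmits to its base station (BS), located at the origin of $\mathbb R^2$. BSs form a homogeneous Poisson point process of intensity $\lambda$; all channel power gains are exponential with unit mean; all devices use full channel inversion with threshold $\rho$ towards the nearest BS, i.e. a device at distance $r$ from its BS transmits with power $\rho r^{\eta}$. * The test device's channel gain is $h$. * The inter-cell interference is $\mathcal I_{Inter}=\sum_i \mathbf 1\{P_i\|u_i\|^{-\eta}<\rho\}\,P_i h_i\|u_i\|^{-\eta}$, where $\{u_i\}$ is a homogeneous Poisson point process of intensity $\tilde{\mathcal U}$, the $h_i$ are channel gains, and the $P_i$ are i.i.d., distributed as the transmit power of a device at the origin served by its nearest BS. * The intra-cell interference is $\mathcal I_{Intra}=\sum_{n=1}^{\mathcal N}\rho g_n$, where the $g_n$ are channel gains and $\mathcal N$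 is the number of points of a Poisson process of intensity $\tilde{\mathcal U}$ in a cell whose area has the gamma density $\frac{(c\lambda)^c}{\Gamma(c)}x^{c-1}e^{-c\lambda x}$, $x>0$ (the usual approximation to the area of a Poisson–Voronoi cell). * The variables $h$, $\{u_i\}$, $\mathcal N$, all the $P_i$, all the $h_i$ and all the $g_n$ are mutually independent. Then the RACH transmission failure probability $p=\mathbb P\big\{\frac{\rho h}{\sigma^2+\mathcal I_{Intra}+\mathcal I_{Inter}}<\theta\big\}$ of this model is $$p=1-\left(\frac{\mathcal P(1+\theta)}{\mathcal P+\theta}\right)^{c}\exp\left\{-\frac{\sigma^2\theta}{\rho}-\frac{2\theta\,\tilde{\mathcal U}}{(\eta-2)\lambda}\;{}_2F_1\!\left(1,1-\tfrac2\eta;2-\tfrac2\eta;-\theta\right)\right\},\qquad \mathcal P=\frac{c\lambda}{c\lambda+\tilde{\mathcal U}},$$ where ${}_2F_1$ is the Gauss hypergeometric function (analytically continued to $(-\infty,1)$). For $\eta=4$ one has $\theta\,{}_2F_1(1,\tfrac12;\tfrac32;-\theta)=\sqrt\theta\arctan\sqrt\theta$, and hence $$p=1-\left(\frac{\mathcal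 P(1+\theta)}{\mathcal P+\theta}\right)^{c}\exp\left\{-\frac{\sigma^2\theta}{\rho}-\frac{\tilde{\mathcal U}}{\lambda}\sqrt\theta\arctan\sqrt\theta\right\}.$$ -/

import Mathlib

open MeasureTheory ProbabilityTheory
open scoped ENNReal NNReal

namespace RACH

noncomputable section

/-- The Euclidean plane, in which base stations and devices are located. -/
abbrev Plane : Type := EuclideanSpace ℝ (Fin 2)

/-! ### Gauss hypergeometric function on the half-line `z < 1` -/

/-- The Gauss hypergeometric function `₂F₁(a, b; c; z)` for real `z < 1`: the sum of the
hypergeometric series for `-1 < z < 1`, and for `z ≤ -1`, where the series diverges, its analytic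
continuation, given by `(1 - z)⁻ᵃ ₂F₁(a, c - b; c; z / (z - 1))` with `1/2 ≤ z / (z - 1) < 1`. -/
def gaussHypergeometric (a b c z : ℝ) : ℝ :=
  if -1 < z then ₂F₁ a b c z
  else (1 - z) ^ (-a) * ₂F₁ a (c - b) c (z / (z - 1))

/-! ### Poisson point processes -/

/-- The number of points of the random sequence `X` that lie in `B`. -/
def pointCount {Ω E : Type*} (X : ℕ → Ω → E) (B : Set E) (ω : Ω) : ℝ≥0∞ :=
  ∑' i, B.indicator (fun _ => (1 : ℝ≥0∞)) (X i ω)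

/-- The random points `X 0, X 1, …` form a Poisson point process with intensity measure `ν`:
the number of points in a set of finite intensity is Poisson distributed with mean `ν B`, and the
numbers of points in pairwise disjoint sets are independent. (The points are listed as an infinite
sequence, so this is meant for an infinite `ν`.) -/
structure IsPoissonPointProcess {Ω E : Type*} [MeasurableSpace Ω] [MeasurableSpace E]
    (X : ℕ → Ω → E) (ν : Measure E) (μ : Measure Ω) : Prop where
  measurable : ∀ i, Measurable (X i)
  count_law : ∀ B : Set E, MeasurableSet B → ν B ≠ ∞ → ∀ n : ℕ,
    μ {ω | pointCount X B ω = n} = poissonMeasure (ν B).toNNReal {n}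
  count_indep : ∀ (m : ℕ) (B : Fin m → Set E), (∀ j, MeasurableSet (B j)) →
    (∀ j, ν (B j) ≠ ∞) → Pairwise (fun j k => Disjoint (B j) (B k)) →
    iIndepFun (fun j => pointCount X (B j)) μ

/-- Homogeneous Poisson point process in the plane with intensity `κ` (points per unit area). -/
def IsHomogeneousPPP {Ω : Type*} [MeasurableSpace Ω] (X : ℕ → Ω → Plane) (κ : ℝ)
    (μ : Measure Ω) : Prop :=
  IsPoissonPointProcess X (ENNReal.ofReal κ • (volume : Measure Plane)) μ

/-! ### Number of devices in a Voronoi cell -/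

/-- The constant `c = 3.575` of the gamma approximation to the area of a Poisson-Voronoi cell. -/
def voronoiShape : ℝ := 3.575

/-- The gamma approximation to the law of the area of a Voronoi cell of a homogeneous planar
Poisson process of intensity `lam`: shape `c`, rate `c * lam`, hence mean `1 / lam`. -/
def cellAreaLaw (lam : ℝ) : Measure ℝ := gammaMeasure voronoiShape (voronoiShape * lam)

/-- The number of points of a Poisson process of intensity `Ut` in a region of given area `a`:
Poisson distributed with mean `Ut * a`. -/
def poissonCountKernel (Ut : ℝ) : Kernel ℝ ℕ where
  toFun a := poissonMeasure (Ut * a).toNNReal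
  measurable' := by
    refine Measure.measurable_of_measurable_coe _ fun s hs => ?_
    simp only [poissonMeasure, Measure.sum_apply _ hs, Measure.smul_apply, smul_eq_mul]
    refine Measurable.tsum fun n => ?_
    refine Measurable.mul_const ?_ _
    fun_prop

/-- The law of the number of intra-cell interferers: the number of points of a Poisson process of
intensity `Ut` in a cell whose area follows `cellAreaLaw lam`. -/
def neighbourLaw (lam Ut : ℝ) : Measure ℕ := (cellAreaLaw lam).bind (poissonCountKernel Ut)

/-! ### The baseline scheme in one time slot -/

/-- Intensity of the devices that transmit on one given Zadoff-Chu sequence: `U` devices per unit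
area, each transmitting with probability `T` on one of `nZ` equally likely sequences. -/
def sequenceIntensity (T U : ℝ) (nZ : ℕ) : ℝ := T * U / nZ

/-- The random quantities met by a test device that transmits to its base station, located at the
origin of the plane. -/
structure Slot (Ω : Type*) where
  /-- power gain of the channel of the test device -/
  gain : Ω → ℝ
  /-- locations of the base stations -/
  bs : ℕ → Ω → Plane
  /-- locations of the inter-cell interferers -/
  pos : ℕ → Ω → Plane
  /-- transmit powers of the inter-cell interferers -/
  power : ℕ → Ω → ℝ
  /-- channel power gains of the inter-cell interferers -/
  interGain : ℕ → Ω → ℝ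
  /-- number of intra-cell interferers -/
  neighbours : Ω → ℕ
  /-- channel power gains of the intra-cell interferers -/
  intraGain : ℕ → Ω → ℝ

/-- Labels of the independent sources of randomness. -/
inductive Source : Type
  | gain
  | pos
  | neighbours
  | power (i : ℕ)
  | interGain (i : ℕ)
  | intraGain (i : ℕ)

namespace Slot

variable {Ω : Type*} (S : Slot Ω)

/-- The σ-algebra generated by a source of randomness (the sequence of all locations of the
inter-cell interferers counts as one source). -/
@[reducible]
def sigmaAlgebra : Source → MeasurableSpace Ω
  | .gain => MeasurableSpace.comap S.gain inferInstance
  | .pos => MeasurableSpace.comap (fun ω i => S.pos i ω) inferInstance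
  | .neighbours => MeasurableSpace.comap S.neighbours inferInstance
  | .power i => MeasurableSpace.comap (S.power i) inferInstance
  | .interGain i => MeasurableSpace.comap (S.interGain i) inferInstance
  | .intraGain i => MeasurableSpace.comap (S.intraGain i) inferInstance

/-- The transmit power under full inversion power control with threshold `ρ` and path-loss exponent
`η` of a device at the origin which is served by the nearest base station: at distance `r` the
power is `ρ * r ^ η`, so that the average power received by the base station is `ρ`. -/
def typicalPower (ρ η : ℝ) (ω : Ω) : ℝ :=
  ρ * Metric.infDist (0 : Plane) (Set.range fun k => S.bs k ω) ^ η

/-- Aggregate inter-cell interference at the base station at the origin. Interferers whose average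
received power is not below `ρ` are excluded, as they would be served by that base station. -/
def interInterference (ρ η : ℝ) (ω : Ω) : ℝ≥0∞ :=
  ∑' i, {ω | S.power i ω * ‖S.pos i ω‖ ^ (-η) < ρ}.indicator
    (fun ω => ENNReal.ofReal (S.power i ω * S.interGain i ω * ‖S.pos i ω‖ ^ (-η))) ω

/-- Aggregate intra-cell interference: by power control every device of the cell is received with
average power `ρ`. -/
def intraInterference (ρ : ℝ) (ω : Ω) : ℝ≥0∞ :=
  ∑ n ∈ Finset.range (S.neighbours ω), ENNReal.ofReal (ρ * S.intraGain n ω)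

/-- Signal-to-interference-plus-noise ratio of the test device, where `σsq` is the noise power. -/
def sinr (ρ η σsq : ℝ) (ω : Ω) : ℝ≥0∞ :=
  ENNReal.ofReal (ρ * S.gain ω) /
    (ENNReal.ofReal σsq + S.intraInterference ρ ω + S.interInterference ρ η ω)

/-- Probability of transmission failure for the SINR threshold `θ`. -/
def failureProbability [MeasurableSpace Ω] (μ : Measure Ω) (ρ η σsq θ : ℝ) : ℝ :=
  μ.real {ω | S.sinr ρ η σsq ω < ENNReal.ofReal θ}

/-- The laws in the baseline scheme (with the approximations of the stochastic geometry model):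
* Rayleigh fading, i.e. all channel power gains are exponential with unit mean;
* the base stations form a homogeneous Poisson process of intensity `lam`;
* the interfering devices form a homogeneous Poisson process of intensity `Ut`, and
  their transmit powers are independent copies of the power of a device served by its nearest base
  station;
* the number of intra-cell interferers is the number of points of a Poisson process of intensity
  `Ut` in a cell with the approximate gamma distributed area;
* all these sources of randomness are mutually independent. -/
structure IsBaseline [MeasurableSpace Ω] (μ : Measure Ω) (lam Ut ρ η : ℝ) : Prop where
  measurable_gain : Measurable S.gain
  measurable_power : ∀ i, Measurable (S.power i)
  measurable_interGain : ∀ i, Measurable (S.interGain i)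
  measurable_neighbours : Measurable S.neighbours
  measurable_intraGain : ∀ i, Measurable (S.intraGain i)
  gain_law : HasLaw S.gain (expMeasure 1) μ
  interGain_law : ∀ i, HasLaw (S.interGain i) (expMeasure 1) μ
  intraGain_law : ∀ i, HasLaw (S.intraGain i) (expMeasure 1) μ
  bs_law : IsHomogeneousPPP S.bs lam μ
  pos_law : IsHomogeneousPPP S.pos Ut μ
  power_law : ∀ i, IdentDistrib (S.power i) (S.typicalPower ρ η) μ μ
  neighbours_law : HasLaw S.neighbours (neighbourLaw lam Ut) μ
  indep : iIndep S.sigmaAlgebra μ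

end Slot

end

end RACH

namespace RACH

/-! The gain `h` is exponential and independent of everything else. So the transmission succeeds
with conditional probability `exp (-s D)`, where `s = θ / ρ` and `D` is noise plus interference. The
success probability is the Laplace transform of `D` at `s`, and independence splits it into a noise,
an intra-cell and an inter-cell factor (`measure_le_gain`).

Intra-cell: each interferer contributes `1 / (1 + θ)`. Given a cell of area `a`, the Poisson
generating function yields `exp (-Ut a θ / (1 + θ))`, and the Laplace transform of the gamma law
turns this into a `c`-th power.

Inter-cell: integrating out gains and powers leaves a product over the points of a Poisson process
of a function `φ` of the distance. The generating functional gives `exp (-Ut ∫ (1 - φ ‖x‖) dx)`. A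
device at distance `R` from its own base station has power `ρ R ^ η`, and dilating the plane by `R`
reduces its integral to `R ^ 2` times the integral for power `ρ`. Hence the law of the powers enters
only through `E R ^ 2 = 1 / (π lam)`, which follows from the void probabilities of the base
stations. The remaining radial integral becomes, under `x = y ^ (-η)`, Euler's integral for `₂F₁(1,
b; b + 1; -θ)` with `b = 1 - 2 / η`.

Laplace transforms are taken in `[0, ∞]`, so that infinite interference needs no separate treatment.
-/

/-- The function `x ↦ exp (-x)` on `[0, ∞]`. -/
noncomputable def expNeg (x : ℝ≥0∞) : ℝ≥0∞ := EReal.exp (-(x : EReal))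

/-! ### Calculus of `exp (-x)` on `[0, ∞]`. -/

@[simp] lemma expNeg_zero : expNeg 0 = 1 := by simp [expNeg]

@[simp] lemma expNeg_top : expNeg ∞ = 0 := by simp [expNeg]

lemma expNeg_ofReal {x : ℝ} (hx : 0 ≤ x) :
    expNeg (ENNReal.ofReal x) = ENNReal.ofReal (Real.exp (-x)) := by
  rw [expNeg, EReal.coe_ennreal_ofReal, max_eq_left hx, ← EReal.coe_neg, EReal.exp_coe]

lemma expNeg_antitone : Antitone expNeg := fun x y h => by
  unfold expNeg
  exact EReal.exp_monotone (EReal.neg_le_neg_iff.2 (EReal.coe_ennreal_le_coe_ennreal_iff.2 h))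

lemma expNeg_le_one (x : ℝ≥0∞) : expNeg x ≤ 1 := by
  simpa using expNeg_antitone (zero_le : 0 ≤ x)

lemma expNeg_ne_top (x : ℝ≥0∞) : expNeg x ≠ ∞ :=
  ((expNeg_le_one x).trans_lt ENNReal.one_lt_top).ne

lemma continuous_expNeg : Continuous expNeg :=
  ENNReal.continuous_exp.comp (continuous_neg.comp continuous_coe_ennreal_ereal)

@[fun_prop]
lemma measurable_expNeg : Measurable expNeg := continuous_expNeg.measurable

lemma expNeg_add (x y : ℝ≥0∞) : expNeg (x + y) = expNeg x * expNeg y := by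
  unfold expNeg
  rw [← EReal.exp_add, EReal.coe_ennreal_add, EReal.neg_add, sub_eq_add_neg]
  · exact Or.inl (EReal.coe_ennreal_ne_bot x)
  · exact Or.inr (EReal.coe_ennreal_ne_bot y)

lemma expNeg_sum {ι : Type*} (s : Finset ι) (f : ι → ℝ≥0∞) :
    expNeg (∑ i ∈ s, f i) = ∏ i ∈ s, expNeg (f i) := by
  classical
  induction s using Finset.induction_on with
  | empty => simp
  | insert a s ha ih => rw [Finset.sum_insert ha, Finset.prod_insert ha, expNeg_add, ih]

lemma expNeg_mul_natCast (x : ℝ≥0∞) (n : ℕ) : expNeg (x * n) = expNeg x ^ n := by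
  induction n with
  | zero => simp
  | succ n ih => rw [Nat.cast_succ, mul_add, mul_one, expNeg_add, ih, pow_succ]

lemma expNeg_iSup (f : ℕ → ℝ≥0∞) : expNeg (⨆ n, f n) = ⨅ n, expNeg (f n) :=
  expNeg_antitone.map_ciSup_of_continuousAt continuous_expNeg.continuousAt

/-- An infinite product of factors in `[0, 1]` is the infimum of its decreasing partial products. In
this form monotone convergence reduces it to finitely many interferers. -/
lemma expNeg_tsum (f : ℕ → ℝ≥0∞) :
    expNeg (∑' i, f i) = ⨅ n, ∏ i ∈ Finset.range n, expNeg (f i) := by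
  rw [ENNReal.tsum_eq_iSup_nat, expNeg_iSup]
  simp_rw [expNeg_sum]

/-- The function `x ↦ -log x` on `[0, 1]`, truncated at `0` for larger arguments. -/
noncomputable def negLog (x : ℝ≥0∞) : ℝ≥0∞ := (-ENNReal.log x).toENNReal

@[fun_prop]
lemma measurable_negLog : Measurable negLog := by
  unfold negLog
  exact measurable_ereal_toENNReal.comp (ENNReal.measurable_log.neg)

/-- Lets any `[0, 1]`-valued function be written as `exp (-g)`, which carries the Laplace functional
over to the generating functional. -/
lemma expNeg_negLog {x : ℝ≥0∞} (hx : x ≤ 1) : expNeg (negLog x) = x := by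
  unfold expNeg negLog
  rw [EReal.coe_toENNReal, neg_neg, ENNReal.exp_log]
  rw [EReal.neg_nonneg]
  simpa using hx

/-! ### Transforms of the gamma, exponential and Poisson laws. -/

/-- Laplace transform of a gamma law. -/
lemma lintegral_expNeg_gammaMeasure {a r s : ℝ} (ha : 0 < a) (hr : 0 < r) (hs : 0 ≤ s) :
    ∫⁻ x, expNeg (ENNReal.ofReal s * ENNReal.ofReal x) ∂(gammaMeasure a r) =
      ENNReal.ofReal ((r / (r + s)) ^ a) := by
  have hrs : 0 < r + s := by linarith
  rw [gammaMeasure, lintegral_withDensity_eq_lintegral_mul _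
    (by unfold gammaPDF; fun_prop) (by fun_prop)]
  -- Exponential tilting: `exp (-s x)` times the density of rate `r` is a constant times the density
  -- of rate `r + s`, which has total mass one.
  have key : ∀ x, (gammaPDF a r * fun x => expNeg (ENNReal.ofReal s * ENNReal.ofReal x)) x =
      ENNReal.ofReal ((r / (r + s)) ^ a) * gammaPDF a (r + s) x := by
    intro x
    rcases lt_or_ge x 0 with hx | hx
    · simp [gammaPDF_of_neg hx]
    · have hG := Real.Gamma_pos_of_pos ha
      rw [Pi.mul_apply, gammaPDF_of_nonneg hx, gammaPDF_of_nonneg hx, ← ENNReal.ofReal_mul hs,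
        expNeg_ofReal (by positivity), ← ENNReal.ofReal_mul (by positivity),
        ← ENNReal.ofReal_mul (by positivity), Real.div_rpow hr.le hrs.le]
      have : (r + s) ^ a ≠ 0 := (Real.rpow_pos_of_pos hrs a).ne'
      congr 1
      rw [show -((r + s) * x) = -(r * x) + -(s * x) by ring, Real.exp_add]
      field_simp
  simp_rw [key]
  rw [lintegral_const_mul _ (by unfold gammaPDF; fun_prop), lintegral_gammaPDF_eq_one ha hrs,
    mul_one]

/-- Laplace transform of the standard exponential law. -/
lemma lintegral_expNeg_expMeasure {s : ℝ≥0∞} (hs : s ≠ ∞) :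
    ∫⁻ x, expNeg (s * ENNReal.ofReal x) ∂(expMeasure 1) = (1 + s)⁻¹ := by
  obtain ⟨t, ht, rfl⟩ : ∃ t : ℝ, 0 ≤ t ∧ s = ENNReal.ofReal t :=
    ⟨s.toReal, ENNReal.toReal_nonneg, (ENNReal.ofReal_toReal hs).symm⟩
  rw [expMeasure, lintegral_expNeg_gammaMeasure one_pos one_pos ht, Real.rpow_one, one_div,
    ENNReal.ofReal_inv_of_pos (by positivity), ENNReal.ofReal_add zero_le_one ht,
    ENNReal.ofReal_one]

lemma expMeasure_absolutelyContinuous : expMeasure 1 ≪ volume := by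
  unfold expMeasure gammaMeasure
  exact withDensity_absolutelyContinuous _ _

lemma expMeasure_Iic_zero : expMeasure 1 (Set.Iic 0) = 0 := by
  have := isProbabilityMeasure_expMeasure one_pos
  have h := cdf_expMeasure_eq one_pos 0
  rw [cdf_eq_real, measureReal_def] at h
  have h2 : (expMeasure 1 (Set.Iic 0)).toReal = 0 := by rw [h]; simp
  exact (ENNReal.toReal_eq_zero_iff _).1 h2 |>.resolve_right (measure_ne_top _ _)

/-- Tail of the standard exponential law. -/
lemma expMeasure_setOf_le_ofReal (a : ℝ≥0∞) :
    expMeasure 1 {x | a ≤ ENNReal.ofReal x} = expNeg a := by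
  have := isProbabilityMeasure_expMeasure one_pos
  rcases eq_or_ne a ∞ with rfl | ha
  · simp
  obtain ⟨t, ht, rfl⟩ : ∃ t : ℝ, 0 ≤ t ∧ a = ENNReal.ofReal t :=
    ⟨a.toReal, ENNReal.toReal_nonneg, (ENNReal.ofReal_toReal ha).symm⟩
  -- For threshold `0` the set is all of `ℝ`, not `Ici 0`, because `ENNReal.ofReal` truncates
  -- negative numbers.
  rcases ht.eq_or_lt with rfl | ht'
  · simp
  have h1 : {x | ENNReal.ofReal t ≤ ENNReal.ofReal x} = Set.Ici t := by
    ext x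
    simp only [Set.mem_ofPred_eq, Set.mem_Ici]
    exact ⟨fun h => (ENNReal.ofReal_le_ofReal_iff' .. |>.1 h).resolve_right (by linarith),
      fun h => ENNReal.ofReal_le_ofReal h⟩
  have hat : expMeasure 1 {t} = 0 := expMeasure_absolutelyContinuous (by simp)
  have h2 : expMeasure 1 (Set.Ici t) = expMeasure 1 (Set.Iic t)ᶜ := by
    rw [Set.compl_Iic, ← Set.Ioi_union_left, Set.union_comm]
    refine le_antisymm ((measure_union_le _ _).trans (by simp [hat])) (measure_mono (by simp))
  rw [h1, h2, expNeg_ofReal ht, ← ofReal_measureReal, probReal_compl_eq_one_sub measurableSet_Iic,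
    ← cdf_eq_real, cdf_expMeasure_eq one_pos, if_pos ht]
  simp

/-- Probability generating function of a Poisson law. -/
lemma tsum_poissonMeasure_mul_pow (r : ℝ≥0) {z : ℝ≥0∞} (hz : z ≤ 1) :
    ∑' n : ℕ, poissonMeasure r {n} * z ^ n = expNeg ((1 - z) * r) := by
  have hz' : z ≠ ∞ := (hz.trans_lt ENNReal.one_lt_top).ne
  obtain ⟨y, hy, rfl⟩ : ∃ t : ℝ, 0 ≤ t ∧ z = ENNReal.ofReal t :=
    ⟨z.toReal, ENNReal.toReal_nonneg, (ENNReal.ofReal_toReal hz').symm⟩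
  have hy1 : y ≤ 1 := by simpa using hz
  have hs : HasSum (fun n : ℕ => Real.exp (-r) * ((r * y) ^ n / n.factorial))
      (Real.exp (-r) * Real.exp (r * y)) := by
    have := (NormedSpace.expSeries_div_hasSum_exp ((r : ℝ) * y)).mul_left (Real.exp (-r))
    rwa [← Real.exp_eq_exp_ℝ] at this
  have h1 : ∀ n : ℕ, poissonMeasure r {n} * ENNReal.ofReal y ^ n =
      ENNReal.ofReal (Real.exp (-r) * ((r * y) ^ n / n.factorial)) := by
    intro n
    rw [poissonMeasure_singleton, ← ENNReal.ofReal_pow hy, ← ENNReal.ofReal_mul (by positivity)]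
    congr 1
    rw [mul_pow]; ring
  simp_rw [h1]
  rw [← ENNReal.ofReal_tsum_of_nonneg (fun n => by positivity) hs.summable, hs.tsum_eq,
    ← Real.exp_add, ← ENNReal.ofReal_one, ← ENNReal.ofReal_sub _ hy, ← ENNReal.ofReal_coe_nnreal,
    ← ENNReal.ofReal_mul (by linarith), expNeg_ofReal (by
      have := r.coe_nonneg
      have : 0 ≤ 1 - y := by linarith
      positivity)]
  congr 2
  ring

/-! ### Laplace and generating functionals of a Poisson point process. -/

section PointProcess

variable {Ω E : Type*} [MeasurableSpace Ω] [MeasurableSpace E] {X : ℕ → Ω → E} {ν : Measure E}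
  {μ : Measure Ω}

lemma measurable_pointCount (hX : ∀ i, Measurable (X i)) {B : Set E} (hB : MeasurableSet B) :
    Measurable (pointCount X B) := by
  unfold pointCount
  exact Measurable.tsum fun i => (measurable_const.indicator hB).comp (hX i)

/-- Laplace transform of the number of points in a set of finite intensity. -/
lemma IsPoissonPointProcess.lintegral_expNeg_mul_pointCount [IsProbabilityMeasure μ]
    (h : IsPoissonPointProcess X ν μ) {B : Set E} (hB : MeasurableSet B) (hνB : ν B ≠ ∞)
    (y : ℝ≥0∞) :
    ∫⁻ ω, expNeg (y * pointCount X B ω) ∂μ = expNeg ((1 - expNeg y) * ν B) := by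
  set A : ℕ → Set Ω := fun n => {ω | pointCount X B ω = n} with hA
  have hN := measurable_pointCount h.measurable hB
  have hAm : ∀ n, MeasurableSet (A n) := fun n => hN (measurableSet_singleton _)
  have hAd : Pairwise (Function.onFun Disjoint A) := by
    intro m n hmn
    refine Set.disjoint_left.2 fun ω hm hn => hmn ?_
    have : (m : ℝ≥0∞) = n := hm.symm.trans hn
    exact_mod_cast this
  -- The law of the count is given only at finite values. The Poisson weights sum to one (generating
  -- function at `1`), so an infinite count has probability zero.
  have hU : μ (⋃ n, A n) = 1 := by
    rw [measure_iUnion hAd hAm]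
    simp_rw [hA, h.count_law B hB hνB]
    simpa using tsum_poissonMeasure_mul_pow (ν B).toNNReal le_rfl
  have hU' : ∀ᵐ ω ∂μ, ω ∈ ⋃ n, A n := by
    rw [← prob_compl_eq_zero_iff (MeasurableSet.iUnion hAm)] at hU
    exact hU
  rw [← setLIntegral_univ, ← setLIntegral_congr (s := ⋃ n, A n) (by
    filter_upwards [hU'] with ω hω
    exact propext ⟨fun _ => trivial, fun _ => hω⟩), lintegral_iUnion hAm hAd]
  have : ∀ n, ∫⁻ ω in A n, expNeg (y * pointCount X B ω) ∂μ =
      poissonMeasure (ν B).toNNReal {n} * expNeg y ^ n := by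
    intro n
    rw [← h.count_law B hB hνB, setLIntegral_congr_fun (g := fun _ => expNeg y ^ n) (hAm n)
      (fun ω hω => by
        have : pointCount X B ω = n := hω
        simp only [this, expNeg_mul_natCast]), setLIntegral_const, mul_comm]
  simp_rw [this]
  rw [tsum_poissonMeasure_mul_pow _ (expNeg_le_one y), ENNReal.coe_toNNReal hνB]

/-- Decomposition of a function of a simple function according to its nonzero values. -/
lemma comp_simpleFunc_eq_sum (g : SimpleFunc E ℝ≥0∞) (F : ℝ≥0∞ → ℝ≥0∞) (hF : F 0 = 0) (x : E) :
    F (g x) = ∑ y ∈ g.range.filter (· ≠ 0), F y * (g ⁻¹' {y}).indicator (fun _ => 1) x := by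
  by_cases hx : g x = 0
  · rw [hx, hF]
    refine (Finset.sum_eq_zero fun y hy => ?_).symm
    rw [Set.indicator_of_notMem, mul_zero]
    intro hxy
    exact (Finset.mem_filter.1 hy).2 ((show g x = y from hxy).symm.trans hx)
  · rw [Finset.sum_eq_single (g x)]
    · rw [Set.indicator_of_mem (by simp), mul_one]
    · intro y _ hy
      rw [Set.indicator_of_notMem, mul_zero]
      exact fun hxy => hy (show g x = y from hxy).symm
    · intro h
      exact absurd (Finset.mem_filter.2 ⟨SimpleFunc.mem_range_self g x, hx⟩) h

/-- Laplace functional of a Poisson point process at a simple function. -/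
lemma IsPoissonPointProcess.lintegral_expNeg_tsum_simpleFunc [IsProbabilityMeasure μ]
    (h : IsPoissonPointProcess X ν μ) (g : SimpleFunc E ℝ≥0∞)
    (hg : ∀ y ≠ 0, ν (g ⁻¹' {y}) ≠ ∞) :
    ∫⁻ ω, expNeg (∑' i, g (X i ω)) ∂μ = expNeg (∫⁻ x, (1 - expNeg (g x)) ∂ν) := by
  -- The level set of the value `0` may have infinite intensity. It is dropped at no cost, since
  -- points there contribute nothing to either side.
  set s := g.range.filter (· ≠ 0) with hs
  let e := s.equivFin
  let y : Fin s.card → ℝ≥0∞ := fun j => (e.symm j : ℝ≥0∞)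
  let B : Fin s.card → Set E := fun j => g ⁻¹' {y j}
  have hsum : ∀ f : ℝ≥0∞ → ℝ≥0∞, ∑ z ∈ s, f z = ∑ j, f (y j) := fun f => by
    rw [← Finset.sum_coe_sort, ← Equiv.sum_comp e.symm]
  have hB : ∀ j, MeasurableSet (B j) := fun j => g.measurableSet_preimage _
  have hνB : ∀ j, ν (B j) ≠ ∞ := fun j => hg _ (Finset.mem_filter.1 (e.symm j).2).2
  have hd : Pairwise (fun j k => Disjoint (B j) (B k)) := by
    intro j k hjk
    refine Set.disjoint_left.2 fun x hj hk => hjk ?_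
    have : y j = y k := (show g x = y j from hj).symm.trans hk
    exact e.symm.injective (Subtype.ext this)
  have hind := h.count_indep _ B hB hνB hd
  have h1 : ∀ ω, ∑' i, g (X i ω) = ∑ j, y j * pointCount X (B j) ω := by
    intro ω
    have : ∀ i, g (X i ω) = ∑ j, y j * (B j).indicator (fun _ => 1) (X i ω) := fun i =>
      (comp_simpleFunc_eq_sum g id rfl (X i ω)).trans (hsum _)
    simp_rw [this]
    rw [Summable.tsum_finsetSum fun j _ => ENNReal.summable]
    simp_rw [ENNReal.tsum_mul_left]
    rfl
  have h2 : ∀ x, 1 - expNeg (g x) = ∑ j, (1 - expNeg (y j)) * (B j).indicator (fun _ => 1) x :=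
    fun x => (comp_simpleFunc_eq_sum g (fun z => 1 - expNeg z) (by simp) x).trans (hsum _)
  simp_rw [h1, h2, expNeg_sum]
  rw [lintegral_prod_eq_prod_lintegral_of_indepFun Finset.univ
    (fun j ω => expNeg (y j * pointCount X (B j) ω))
    (hind.comp (fun j z => expNeg (y j * z)) (fun j => by fun_prop))
    (fun j => by have := measurable_pointCount h.measurable (hB j); fun_prop)]
  simp_rw [h.lintegral_expNeg_mul_pointCount (hB _) (hνB _)]
  rw [← expNeg_sum, lintegral_finsetSum _ (fun j _ => by
    exact (measurable_const.indicator (hB j)).const_mul _)]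
  congr 1
  refine Finset.sum_congr rfl fun j _ => ?_
  rw [lintegral_const_mul _ (measurable_const.indicator (hB j)), lintegral_indicator_const (hB j),
    one_mul]

/-- Laplace functional of a Poisson point process. -/
theorem IsPoissonPointProcess.lintegral_expNeg_tsum [IsProbabilityMeasure μ] [SigmaFinite ν]
    (h : IsPoissonPointProcess X ν μ) {g : E → ℝ≥0∞} (hg : Measurable g) :
    ∫⁻ ω, expNeg (∑' i, g (X i ω)) ∂μ = expNeg (∫⁻ x, (1 - expNeg (g x)) ∂ν) := by
  -- Cutting off to the spanning sets gives the nonzero level sets finite intensity and keeps the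
  -- sequence increasing to `g`.
  let G : ℕ → SimpleFunc E ℝ≥0∞ := fun n =>
    (SimpleFunc.eapprox g n).restrict (spanningSets ν n)
  have hG : ∀ n, (G n : E → ℝ≥0∞) = (spanningSets ν n).indicator (SimpleFunc.eapprox g n) :=
    fun n => SimpleFunc.coe_restrict _ (measurableSet_spanningSets ν n)
  have hmono : ∀ x, Monotone fun n => G n x := by
    intro x m n hmn
    simp only [hG]
    refine (Set.indicator_le_indicator_of_subset (monotone_spanningSets ν hmn)
      (fun _ => zero_le) x).trans ?_
    exact Set.indicator_le_indicator (SimpleFunc.monotone_eapprox g hmn x)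
  have hsup : ∀ x, ⨆ n, G n x = g x := by
    intro x
    refine le_antisymm (iSup_le fun n => ?_) ?_
    · rw [hG]
      refine (Set.indicator_le_self' (fun _ _ => zero_le) x).trans ?_
      rw [← SimpleFunc.iSup_eapprox_apply hg x]
      exact le_iSup (fun n => SimpleFunc.eapprox g n x) n
    · rw [← SimpleFunc.iSup_eapprox_apply hg x]
      refine iSup_le fun n => ?_
      obtain ⟨m, hm⟩ : ∃ m, x ∈ spanningSets ν m := by
        have : x ∈ ⋃ m, spanningSets ν m := by rw [iUnion_spanningSets]; trivial
        exact Set.mem_iUnion.1 this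
      refine le_iSup_of_le (max m n) ?_
      rw [hG, Set.indicator_of_mem (monotone_spanningSets ν (le_max_left m n) hm)]
      exact SimpleFunc.monotone_eapprox g (le_max_right m n) x
  have hfin : ∀ n, ∀ y ≠ 0, ν (G n ⁻¹' {y}) ≠ ∞ := by
    intro n y hy
    refine ((measure_mono ?_).trans_lt (measure_spanningSets_lt_top ν n)).ne
    intro x hx
    by_contra hxs
    have hx' : G n x = y := hx
    rw [hG, Set.indicator_of_notMem hxs] at hx'
    exact hy hx'.symm
  have key := fun n => h.lintegral_expNeg_tsum_simpleFunc (G n) (hfin n)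
  have hGm : ∀ n, Measurable (G n) := fun n => (G n).measurable
  have hXm := h.measurable
  have hL : ∀ ω, expNeg (∑' i, g (X i ω)) = ⨅ n, expNeg (∑' i, G n (X i ω)) := by
    intro ω
    rw [← expNeg_iSup]
    congr 1
    -- The sum over points is an integral against counting measure, so supremum and sum commute by
    -- monotone convergence.
    simp_rw [← hsup, ← lintegral_count]
    exact lintegral_iSup (fun n => measurable_of_countable _) (fun m n hmn i => hmono _ hmn)
  have hR : ∀ x, 1 - expNeg (g x) = ⨆ n, (1 - expNeg (G n x)) := by
    intro x
    rw [← hsup, expNeg_iSup, ENNReal.sub_iInf]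
  simp_rw [hL, hR]
  rw [lintegral_iInf, lintegral_iSup, expNeg_iSup]
  · exact iInf_congr key
  · intro n; fun_prop
  · exact fun m n hmn x => tsub_le_tsub_left (expNeg_antitone (hmono x hmn)) 1
  · exact fun n => measurable_expNeg.comp (Measurable.tsum fun i => (hGm n).comp (hXm i))
  · exact fun m n hmn ω => expNeg_antitone (ENNReal.tsum_le_tsum fun i => hmono _ hmn)
  · exact ((lintegral_mono fun ω => expNeg_le_one _).trans_lt (by simp)).ne

/-- Probability generating functional of a Poisson point process. -/
theorem IsPoissonPointProcess.lintegral_iInf_prod [IsProbabilityMeasure μ] [SigmaFinite ν]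
    (h : IsPoissonPointProcess X ν μ) {φ : E → ℝ≥0∞} (hφ : Measurable φ) (hφ1 : ∀ x, φ x ≤ 1) :
    ∫⁻ ω, ⨅ n, ∏ i ∈ Finset.range n, φ (X i ω) ∂μ = expNeg (∫⁻ x, (1 - φ x) ∂ν) := by
  have := h.lintegral_expNeg_tsum (measurable_negLog.comp hφ)
  simp only [Function.comp_apply, expNeg_tsum, expNeg_negLog (hφ1 _)] at this
  exact this

end PointProcess

/-! ### Integrating out independent variables. -/

section Independence

variable {Ω A B : Type*} {m : MeasurableSpace Ω} [mΩ : MeasurableSpace Ω] [MeasurableSpace A]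
  [MeasurableSpace B] {μ : Measure Ω}

/-- Integrating out a random variable which is independent of everything else. -/
lemma lintegral_mul_comp_of_indep [IsProbabilityMeasure μ] (hm : m ≤ mΩ) {K : Ω → ℝ≥0∞}
    (hK : Measurable[m] K) {X : Ω → A} (hX : Measurable[m] X)
    {Y : Ω → B} (hY : Measurable Y) (hind : Indep m (MeasurableSpace.comap Y inferInstance) μ)
    {F : A → B → ℝ≥0∞} (hF : Measurable (Function.uncurry F)) :
    ∫⁻ ω, K ω * F (X ω) (Y ω) ∂μ = ∫⁻ ω, K ω * ∫⁻ y, F (X ω) y ∂(μ.map Y) ∂μ := by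
  have hK' := hK.mono hm le_rfl
  have hX' := hX.mono hm le_rfl
  let W : Ω → ℝ≥0∞ × A := fun ω => (K ω, X ω)
  have hW : Measurable W := hK'.prodMk hX'
  have hWm : Measurable[m] W := hK.prodMk hX
  have hWY : IndepFun W Y μ := indep_of_indep_of_le_left hind hWm.comap_le
  have hYp : IsProbabilityMeasure (μ.map Y) := Measure.isProbabilityMeasure_map hY.aemeasurable
  have hF' : Measurable fun p : (ℝ≥0∞ × A) × B => p.1.1 * F p.1.2 p.2 :=
    (measurable_fst.comp measurable_fst).mul
      (hF.comp ((measurable_snd.comp measurable_fst).prodMk measurable_snd))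
  have h1 := (indepFun_iff_map_prod_eq_prod_map_map hW.aemeasurable hY.aemeasurable).1 hWY
  calc ∫⁻ ω, K ω * F (X ω) (Y ω) ∂μ
      = ∫⁻ p, p.1.1 * F p.1.2 p.2 ∂(μ.map fun ω => (W ω, Y ω)) := by
        rw [lintegral_map hF' (hW.prodMk hY)]
    _ = ∫⁻ w, ∫⁻ y, w.1 * F w.2 y ∂(μ.map Y) ∂(μ.map W) := by
        rw [h1, lintegral_prod _ hF'.aemeasurable]
    _ = ∫⁻ ω, ∫⁻ y, K ω * F (X ω) y ∂(μ.map Y) ∂μ := by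
        rw [lintegral_map hF'.lintegral_prod_right' hW]
    _ = _ := by
        refine lintegral_congr fun ω => ?_
        exact lintegral_const_mul _ (hF.comp measurable_prodMk_left)

/-- Integrating out a sequence of independent random variables in a product. -/
lemma lintegral_mul_prod_of_indep [IsProbabilityMeasure μ] {m : ℕ → MeasurableSpace Ω}
    (hm : ∀ k, m k ≤ mΩ) (hmono : Monotone m) {X : Ω → A} (hX : Measurable[m 0] X)
    {Y : ℕ → Ω → B} (hY : ∀ k, Measurable (Y k)) (hYm : ∀ k, Measurable[m (k + 1)] (Y k))
    (hind : ∀ k, Indep (m k) (MeasurableSpace.comap (Y k) inferInstance) μ)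
    {F : ℕ → A → B → ℝ≥0∞} (hF : ∀ k, Measurable (Function.uncurry (F k))) (n : ℕ) :
    ∀ {K : Ω → ℝ≥0∞}, Measurable[m 0] K →
    ∫⁻ ω, K ω * ∏ i ∈ Finset.range n, F i (X ω) (Y i ω) ∂μ =
      ∫⁻ ω, K ω * ∏ i ∈ Finset.range n, ∫⁻ y, F i (X ω) y ∂(μ.map (Y i)) ∂μ := by
  induction n with
  | zero => intro K _; simp
  | succ n ih =>
    intro K hK
    have hYp : ∀ k, IsProbabilityMeasure (μ.map (Y k)) := fun k =>
      Measure.isProbabilityMeasure_map (hY k).aemeasurable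
    have hXn : Measurable[m n] X := hX.mono (hmono (Nat.zero_le n)) le_rfl
    have hφ : Measurable fun x => ∫⁻ y, F n x y ∂(μ.map (Y n)) := (hF n).lintegral_prod_right'
    simp_rw [Finset.prod_range_succ, ← mul_assoc]
    rw [lintegral_mul_comp_of_indep (hm n) (K := fun ω => K ω * ∏ i ∈ Finset.range n,
        F i (X ω) (Y i ω)) ?_ hXn (hY n) (hind n) (hF n)]
    · have := ih (K := fun ω => K ω * ∫⁻ y, F n (X ω) y ∂(μ.map (Y n)))
        (hK.mul (hφ.comp hX))
      simp_rw [mul_right_comm (K _)] at this ⊢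
      exact this
    · refine Measurable.mul (hK.mono (hmono (Nat.zero_le n)) le_rfl) ?_
      refine Finset.measurable_fun_prod _ fun i hi => ?_
      have hYi : Measurable[m n] (Y i) :=
        (hYm i).mono (hmono (Nat.succ_le_of_lt (Finset.mem_range.1 hi))) le_rfl
      exact (hF i).comp (hXn.prodMk hYi)

end Independence

/-! ### Euler's integral for the hypergeometric function. -/

section Hypergeometric

open Polynomial Set

lemma integrableOn_rpow_mul_of_bounded {b C : ℝ} (hb : 0 < b) {f : ℝ → ℝ} (hf : Measurable f)
    (hC : ∀ x ∈ Ioo (0 : ℝ) 1, |f x| ≤ C) :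
    IntegrableOn (fun x => x ^ (b - 1) * f x) (Ioo 0 1) := by
  have h := (intervalIntegral.integrableOn_Ioo_rpow_iff (s := b - 1) one_pos).2 (by linarith)
  refine Integrable.mono' (h.mul_const C) (by fun_prop) ?_
  refine (ae_restrict_iff' measurableSet_Ioo).2 (ae_of_all _ fun x hx => ?_)
  have h0 : 0 ≤ x ^ (b - 1) := Real.rpow_nonneg hx.1.le _
  rw [norm_mul, Real.norm_of_nonneg h0]
  exact mul_le_mul_of_nonneg_left (hC x hx) h0

lemma setIntegral_rpow_sub_one {b : ℝ} (hb : 0 < b) : ∫ x in Ioo (0 : ℝ) 1, x ^ (b - 1) = b⁻¹ := by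
  rw [← integral_Ioc_eq_integral_Ioo, ← intervalIntegral.integral_of_le zero_le_one,
    integral_rpow (Or.inl (by linarith))]
  simp [hb.ne']

lemma eval_ascPochhammer_succ_left (b : ℝ) (n : ℕ) :
    (ascPochhammer ℝ (n + 1)).eval b = b * (ascPochhammer ℝ n).eval (b + 1) := by
  rw [ascPochhammer_succ_left]
  simp [eval_comp]

/-- Euler's beta integral with an integer parameter. -/
lemma setIntegral_rpow_mul_one_sub_pow (n : ℕ) {b : ℝ} (hb : 0 < b) :
    ∫ x in Ioo (0 : ℝ) 1, x ^ (b - 1) * (1 - x) ^ n =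
      n.factorial / (ascPochhammer ℝ (n + 1)).eval b := by
  have hint : ∀ (m : ℕ) {a : ℝ}, 0 < a →
      IntegrableOn (fun x : ℝ => x ^ (a - 1) * (1 - x) ^ m) (Ioo 0 1) := fun m a ha =>
    integrableOn_rpow_mul_of_bounded (C := 1) ha (by fun_prop) fun x hx => by
      rw [abs_of_nonneg (pow_nonneg (by linarith [hx.2]) _)]
      exact pow_le_one₀ (by linarith [hx.2]) (by linarith [hx.1])
  induction n generalizing b with
  | zero => simpa using setIntegral_rpow_sub_one hb
  | succ n ih =>
    -- Expanding one factor `1 - x` expresses the integral by those for `b` and `b + 1` with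
    -- exponent `n`. Both resulting rising factorials divide that of length `n + 2` at `b`.
    have h1 : ∫ x in Ioo (0 : ℝ) 1, x ^ (b - 1) * (1 - x) ^ (n + 1) =
        ∫ x in Ioo (0 : ℝ) 1, (x ^ (b - 1) * (1 - x) ^ n - x ^ (b + 1 - 1) * (1 - x) ^ n) := by
      refine setIntegral_congr_fun measurableSet_Ioo fun x hx => ?_
      have : x ^ (b + 1 - 1) = x ^ (b - 1) * x := by
        rw [show b + 1 - 1 = b - 1 + 1 by ring, Real.rpow_add_one hx.1.ne']
      simp only [this]
      ring
    have hb1 : 0 < b + 1 := by linarith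
    rw [h1, integral_sub (hint n hb) (hint n hb1), ih hb, ih hb1]
    have e1 := eval_ascPochhammer_succ_left b (n + 1)
    have e2 := ascPochhammer_succ_eval (n + 1) b
    have p1 := ascPochhammer_pos (n + 1) b hb
    have p2 := ascPochhammer_pos (n + 1) (b + 1) hb1
    have p3 := ascPochhammer_pos (n + 1 + 1) b hb
    set A := (ascPochhammer ℝ (n + 1)).eval b
    set B := (ascPochhammer ℝ (n + 1)).eval (b + 1)
    set D := (ascPochhammer ℝ (n + 1 + 1)).eval b
    push_cast at e2
    have hA : A = D / (b + (n + 1)) := by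
      rw [e2, mul_div_cancel_right₀ _ (by positivity)]
    have hB : B = D / b := by rw [e1, mul_div_cancel_left₀ _ hb.ne']
    rw [hA, hB, Nat.factorial_succ]
    push_cast
    field_simp
    ring

/-- Integration of a geometric series against a power. -/
lemma hasSum_setIntegral_rpow_mul_pow {b q : ℝ} (hb : 0 < b) (hq : q < 1) {u : ℝ → ℝ}
    (hu : Measurable u) (huq : ∀ x ∈ Ioo (0 : ℝ) 1, |u x| ≤ q) :
    HasSum (fun n : ℕ => ∫ x in Ioo (0 : ℝ) 1, x ^ (b - 1) * u x ^ n)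
      (∫ x in Ioo (0 : ℝ) 1, x ^ (b - 1) * (1 - u x)⁻¹) := by
  have hq0 : 0 ≤ q := (abs_nonneg _).trans (huq (1 / 2) (by norm_num))
  have hbd : ∀ n : ℕ, ∀ x ∈ Ioo (0 : ℝ) 1, |u x ^ n| ≤ q ^ n := fun n x hx => by
    rw [abs_pow]
    exact pow_le_pow_left₀ (abs_nonneg _) (huq x hx) n
  have hint : ∀ n : ℕ, IntegrableOn (fun x : ℝ => x ^ (b - 1) * u x ^ n) (Ioo 0 1) := fun n =>
    integrableOn_rpow_mul_of_bounded hb (by fun_prop) (hbd n)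
  have hs := hasSum_integral_of_summable_integral_norm hint ?_
  · convert! hs using 1
    refine setIntegral_congr_fun measurableSet_Ioo fun x hx => ?_
    rw [tsum_mul_left, tsum_geometric_of_abs_lt_one ((huq x hx).trans_lt hq)]
  · refine Summable.of_nonneg_of_le (fun n => integral_nonneg fun x => norm_nonneg _) (fun n => ?_)
      ((summable_geometric_of_lt_one hq0 hq).mul_left b⁻¹)
    rw [← setIntegral_rpow_sub_one hb, ← integral_mul_const]
    have h := (intervalIntegral.integrableOn_Ioo_rpow_iff (s := b - 1) one_pos).2 (by linarith)
    refine setIntegral_mono_on (hint n).norm (h.mul_const _) measurableSet_Ioo fun x hx => ?_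
    have h0 : 0 ≤ x ^ (b - 1) := Real.rpow_nonneg hx.1.le _
    rw [norm_mul, Real.norm_of_nonneg h0]
    exact mul_le_mul_of_nonneg_left (hbd n x hx) h0

/-- Euler's integral representation of `₂F₁(1, b; b + 1; -θ)`. -/
theorem gaussHypergeometric_eq_integral {b θ : ℝ} (hb : 0 < b) (hθ : 0 < θ) :
    gaussHypergeometric 1 b (b + 1) (-θ) =
      b * ∫ x in Ioo (0 : ℝ) 1, x ^ (b - 1) * (1 + θ * x)⁻¹ := by
  have hf : ∀ n : ℕ, (n.factorial : ℝ) ≠ 0 := fun n => by positivity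
  have hone : ∀ n : ℕ, (ascPochhammer ℝ n).eval 1 = n.factorial := fun n =>
    ascPochhammer_eval_one ℝ n
  have hpos := fun n : ℕ => (ascPochhammer_pos n (b + 1) (by linarith : 0 < b + 1)).ne'
  unfold gaussHypergeometric
  split_ifs with h
  -- Case `θ < 1`: the integrand expands as a geometric series in `-θ x`.
  · have hs := (hasSum_setIntegral_rpow_mul_pow hb (u := fun x => -θ * x) (q := θ)
      (by linarith) (by fun_prop) (fun x hx => by
        rw [abs_mul, abs_neg, abs_of_pos hθ, abs_of_pos hx.1]
        nlinarith [hx.1, hx.2])).mul_left b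
    have h2 : ∀ x : ℝ, 1 - -θ * x = 1 + θ * x := fun x => by ring
    simp only [h2] at hs
    rw [← hs.tsum_eq, ordinaryHypergeometric_eq_tsum]
    refine tsum_congr fun n => ?_
    have h3 : ∫ x in Ioo (0 : ℝ) 1, x ^ (b - 1) * (-θ * x) ^ n = (-θ) ^ n * (b + n)⁻¹ := by
      rw [← setIntegral_rpow_sub_one (show 0 < b + n by positivity), ← integral_const_mul]
      refine setIntegral_congr_fun measurableSet_Ioo fun x hx => ?_
      rw [show b + n - 1 = b - 1 + n by ring, Real.rpow_add_natCast hx.1.ne', mul_pow]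
      ring
    have e1 := eval_ascPochhammer_succ_left b n
    rw [ascPochhammer_succ_eval] at e1
    have hbn : b + n ≠ 0 := by positivity
    have e2 : (ascPochhammer ℝ n).eval b = b * (ascPochhammer ℝ n).eval (b + 1) / (b + n) := by
      rw [← e1, mul_div_cancel_right₀ _ hbn]
    simp only [smul_eq_mul]
    rw [h3, hone, e2]
    field_simp [hpos n, hf n]
  -- Case `θ ≥ 1`: the expansion uses `1 + θ x = (1 + θ) (1 - θ / (1 + θ) * (1 - x))`, whose ratio
  -- stays below one. The beta integrals then produce the Pfaff-transformed series `₂F₁(1, 1; b + 1;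
  -- θ / (1 + θ))`.
  · have hθ1 : 0 < 1 + θ := by linarith
    have hs := (hasSum_setIntegral_rpow_mul_pow hb (u := fun x => θ / (1 + θ) * (1 - x))
      (q := θ / (1 + θ)) (by rw [div_lt_one hθ1]; linarith) (by fun_prop) (fun x hx => by
        have : 0 < θ / (1 + θ) := by positivity
        rw [abs_mul, abs_of_pos this, abs_of_pos (by linarith [hx.2])]
        nlinarith [hx.1, hx.2])).mul_left (b * (1 + θ)⁻¹)
    have h2 : b * ∫ x in Ioo (0 : ℝ) 1, x ^ (b - 1) * (1 + θ * x)⁻¹ =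
        b * (1 + θ)⁻¹ * ∫ x in Ioo (0 : ℝ) 1, x ^ (b - 1) * (1 - θ / (1 + θ) * (1 - x))⁻¹ := by
      rw [mul_assoc]
      congr 1
      rw [← integral_const_mul]
      refine setIntegral_congr_fun measurableSet_Ioo fun x hx => ?_
      have hx1 : 0 < 1 + θ * x := by have := hx.1; positivity
      have : 1 - θ / (1 + θ) * (1 - x) = (1 + θ * x) / (1 + θ) := by field_simp; ring
      simp only [this]
      field_simp
    rw [h2, ← hs.tsum_eq, ordinaryHypergeometric_eq_tsum, sub_neg_eq_add, Real.rpow_neg_one,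
      show b + 1 - b = 1 by ring, mul_comm b, ← tsum_mul_left]
    refine tsum_congr fun n => ?_
    have h3 : ∫ x in Ioo (0 : ℝ) 1, x ^ (b - 1) * (θ / (1 + θ) * (1 - x)) ^ n =
        (θ / (1 + θ)) ^ n * (n.factorial / (b * (ascPochhammer ℝ n).eval (b + 1))) := by
      rw [← eval_ascPochhammer_succ_left, ← setIntegral_rpow_mul_one_sub_pow n hb,
        ← integral_const_mul]
      refine setIntegral_congr_fun measurableSet_Ioo fun x _ => ?_
      simp only [mul_pow]
      ring
    have h4 : -θ / (-θ - 1) = θ / (1 + θ) := by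
      rw [show -θ - 1 = -(1 + θ) by ring, neg_div_neg_eq]
    simp only [smul_eq_mul]
    rw [h3, hone, h4]
    field_simp [hpos n, hf n]

/-- The antiderivative is `(2 / √θ) arctan (√θ √x)`. It is continuous on `[0, 1]` but differentiated
only in the interior, because of the singularity at `0`. -/
lemma setIntegral_rpow_neg_half_mul_inv {θ : ℝ} (hθ : 0 < θ) :
    ∫ x in Ioo (0 : ℝ) 1, x ^ ((1 / 2 : ℝ) - 1) * (1 + θ * x)⁻¹ =
      2 / √θ * Real.arctan √θ := by
  have hs : 0 < √θ := Real.sqrt_pos.2 hθ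
  have hint : IntegrableOn (fun x : ℝ => x ^ ((1 / 2 : ℝ) - 1) * (1 + θ * x)⁻¹) (Ioo 0 1) :=
    integrableOn_rpow_mul_of_bounded (C := 1) (by norm_num) (by fun_prop) fun x hx => by
      have : 0 < θ * x := mul_pos hθ hx.1
      rw [abs_of_pos (by positivity)]
      exact inv_le_one_of_one_le₀ (by linarith)
  rw [← integral_Ioc_eq_integral_Ioo, ← intervalIntegral.integral_of_le zero_le_one,
    intervalIntegral.integral_eq_sub_of_hasDerivAt_of_le zero_le_one
      (f := fun x => 2 / √θ * Real.arctan (√θ * √x))]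
  · simp
  · exact Continuous.continuousOn (by fun_prop)
  · intro x hx
    have hx0 : 0 < √x := Real.sqrt_pos.2 hx.1
    have h := (((Real.hasDerivAt_sqrt hx.1.ne').const_mul √θ).arctan).const_mul (2 / √θ)
    convert! h using 1
    rw [mul_pow, Real.sq_sqrt hθ.le, Real.sq_sqrt hx.1.le,
      show (1 / 2 : ℝ) - 1 = -(1 / 2) by norm_num, Real.rpow_neg hx.1.le, ← Real.sqrt_eq_rpow]
    field_simp
  · rw [intervalIntegrable_iff_integrableOn_Ioo_of_le zero_le_one]
    exact hint

theorem mul_gaussHypergeometric_half {θ : ℝ} (hθ : 0 < θ) :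
    θ * gaussHypergeometric 1 (1 / 2) (3 / 2) (-θ) = √θ * Real.arctan √θ := by
  rw [show (3 / 2 : ℝ) = 1 / 2 + 1 by norm_num, gaussHypergeometric_eq_integral (by norm_num) hθ,
    setIntegral_rpow_neg_half_mul_inv hθ]
  have hs : 0 < √θ := Real.sqrt_pos.2 hθ
  have h2 := Real.mul_self_sqrt hθ.le
  field_simp
  rw [sq, h2]

end Hypergeometric

open Set

/-! ### Distance to the nearest base station. -/

section NearestBaseStation

variable {Ω : Type*} {X : ℕ → Ω → Plane}

/-- The distance from the origin to the nearest point of a sequence. -/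
noncomputable def nearestDist (X : ℕ → Ω → Plane) (ω : Ω) : ℝ :=
  Metric.infDist (0 : Plane) (range fun k => X k ω)

lemma nearestDist_nonneg (X : ℕ → Ω → Plane) (ω : Ω) : 0 ≤ nearestDist X ω := Metric.infDist_nonneg

/-- The open ball matches the non-strict inequality. The event becomes a void event, whose
probability the Poisson law gives. -/
lemma setOf_le_nearestDist (r : ℝ) :
    {ω | r ≤ nearestDist X ω} = {ω | pointCount X (Metric.ball 0 r) ω = (0 : ℕ)} := by
  ext ω
  simp only [mem_ofPred_eq, nearestDist, pointCount, Nat.cast_zero, ENNReal.tsum_eq_zero,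
    Metric.le_infDist (range_nonempty _), forall_mem_range, dist_zero_left]
  refine forall_congr' fun k => ?_
  simp

variable [MeasurableSpace Ω] {κ : ℝ} {μ : Measure Ω}

lemma measurable_nearestDist (hX : ∀ k, Measurable (X k)) : Measurable (nearestDist X) := by
  refine measurable_of_Ici fun r => ?_
  have := setOf_le_nearestDist (X := X) r
  change MeasurableSet {ω | r ≤ nearestDist X ω}
  rw [this]
  exact measurable_pointCount hX Metric.isOpen_ball.measurableSet (measurableSet_singleton _)

lemma IsHomogeneousPPP.measure_le_nearestDist (h : IsHomogeneousPPP X κ μ) (hκ : 0 ≤ κ) {r : ℝ}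
    (hr : 0 ≤ r) :
    μ {ω | r ≤ nearestDist X ω} = ENNReal.ofReal (Real.exp (-(κ * Real.pi) * r ^ 2)) := by
  have hν : (ENNReal.ofReal κ • (volume : Measure Plane)) (Metric.ball 0 r) =
      ENNReal.ofReal (κ * Real.pi * r ^ 2) := by
    rw [Measure.smul_apply, EuclideanSpace.volume_ball_fin_two, smul_eq_mul,
      ← ENNReal.ofReal_pow hr, ← ENNReal.ofReal_mul (by positivity), ← ENNReal.ofReal_mul hκ]
    congr 1
    ring
  rw [setOf_le_nearestDist, h.count_law _ Metric.isOpen_ball.measurableSet (by simp [hν]),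
    poissonMeasure_singleton, hν, ENNReal.coe_toNNReal_eq_toReal,
    ENNReal.toReal_ofReal (by positivity)]
  simp

/-- Mean squared distance to the nearest point of a homogeneous Poisson process. -/
lemma IsHomogeneousPPP.lintegral_nearestDist_sq (h : IsHomogeneousPPP X κ μ) (hκ : 0 < κ) :
    ∫⁻ ω, ENNReal.ofReal (nearestDist X ω ^ 2) ∂μ = ENNReal.ofReal ((κ * Real.pi)⁻¹) := by
  have hm := measurable_nearestDist h.measurable
  have hπ : 0 < κ * Real.pi := mul_pos hκ Real.pi_pos
  -- Layer-cake formula: the tail of the squared distance at `t` is the void probability `exp (-κ π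
  -- t)`.
  rw [lintegral_eq_lintegral_meas_le μ (ae_of_all _ fun ω => sq_nonneg _) (by fun_prop)]
  have h1 : ∫⁻ t in Ioi (0 : ℝ), μ {ω | t ≤ nearestDist X ω ^ 2} =
      ∫⁻ t in Ioi (0 : ℝ), ENNReal.ofReal (Real.exp (-(κ * Real.pi) * t)) := by
    refine setLIntegral_congr_fun measurableSet_Ioi fun t ht => ?_
    have ht0 : 0 ≤ t := le_of_lt ht
    have h2 : {ω | t ≤ nearestDist X ω ^ 2} = {ω | √t ≤ nearestDist X ω} := by
      ext ω
      exact (Real.sqrt_le_left (nearestDist_nonneg X ω)).symm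
    simp only [h2, h.measure_le_nearestDist hκ.le (Real.sqrt_nonneg t), Real.sq_sqrt ht0]
  rw [h1, ← ofReal_integral_eq_lintegral_ofReal (integrableOn_exp_mul_Ioi (by linarith) 0)
    (ae_of_all _ fun t => (Real.exp_pos _).le), integral_exp_mul_Ioi (by linarith)]
  congr 1
  simp

end NearestBaseStation

/-! ### The plane integral of one interferer's contribution. -/

section PlaneIntegral

/-- Conditional Laplace transform, given its transmit power `p` and its distance `r`, of the
interference of one interferer with exponential channel gain. -/
noncomputable def interfererLaplace (ρ η : ℝ) (s : ℝ≥0∞) (p r : ℝ) : ℝ≥0∞ :=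
  if p * r ^ (-η) < ρ then (1 + s * ENNReal.ofReal (p * r ^ (-η)))⁻¹ else 1

variable {ρ η θ : ℝ} {s : ℝ≥0∞}

lemma interfererLaplace_le_one (p r : ℝ) : interfererLaplace ρ η s p r ≤ 1 := by
  unfold interfererLaplace
  split_ifs
  · exact ENNReal.inv_le_one.2 (by simp)
  · exact le_rfl

lemma measurable_interfererLaplace :
    Measurable fun q : ℝ × ℝ => interfererLaplace ρ η s q.1 q.2 := by
  unfold interfererLaplace
  refine Measurable.ite (measurableSet_lt ?_ measurable_const) ?_ measurable_const <;> fun_prop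

/-- Substitute `x = y ^ (-η)`. The cutoff `x < 1` excludes devices that would belong to the cell of
the origin, and `η > 2` makes the exponent `-2 / η` integrable at `0`, that is, for far interferers.
-/
lemma setIntegral_interference (hη : 2 < η) (hθ : 0 < θ) :
    IntegrableOn (fun y : ℝ => y * (Iio 1).indicator (fun x => θ * x / (1 + θ * x)) (y ^ (-η)))
      (Ioi 0) ∧
    ∫ y in Ioi (0 : ℝ), y * (Iio 1).indicator (fun x => θ * x / (1 + θ * x)) (y ^ (-η)) =
      θ / η * ∫ x in Ioo (0 : ℝ) 1, x ^ ((1 - 2 / η) - 1) * (1 + θ * x)⁻¹ := by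
  have hη0 : 0 < η := by linarith
  have hb : 0 < 1 - 2 / η := by rw [sub_pos, div_lt_one hη0]; exact hη
  set G : ℝ → ℝ := (Iio 1).indicator fun x => x ^ ((1 - 2 / η) - 1) * (1 + θ * x)⁻¹ with hG
  have hIoo : Ioi (0 : ℝ) ∩ Iio 1 = Ioo 0 1 := Ioi_inter_Iio
  have hGi : IntegrableOn G (Ioi 0) := by
    rw [hG, IntegrableOn, integrable_indicator_iff measurableSet_Iio, IntegrableOn,
      Measure.restrict_restrict measurableSet_Iio, inter_comm, hIoo]
    refine integrableOn_rpow_mul_of_bounded (C := 1) hb (by fun_prop) fun x hx => ?_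
    have : 0 < θ * x := mul_pos hθ hx.1
    rw [abs_of_pos (by positivity)]
    exact inv_le_one_of_one_le₀ (by linarith)
  have hGI : ∫ x in Ioi 0, G x =
      ∫ x in Ioo (0 : ℝ) 1, x ^ ((1 - 2 / η) - 1) * (1 + θ * x)⁻¹ := by
    rw [hG, setIntegral_indicator measurableSet_Iio, hIoo]
  have hp : -η ≠ 0 := by linarith
  -- With `x = y ^ (-η)`, the Jacobian times `x ^ (-2 / η)` is `η y ^ (-η - 1) * y ^ 2 = η y x`,
  -- which accounts for the factor `θ / η`.
  have key : ∀ y ∈ Ioi (0 : ℝ),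
      y * (Iio 1).indicator (fun x => θ * x / (1 + θ * x)) (y ^ (-η)) =
        θ / η * ((|-η| * y ^ (-η - 1)) • G (y ^ (-η))) := by
    intro y hy
    have hy0 : 0 < y := hy
    by_cases h1 : y ^ (-η) < 1
    · rw [hG, indicator_of_mem (show y ^ (-η) ∈ Iio 1 from h1),
        indicator_of_mem (show y ^ (-η) ∈ Iio 1 from h1), abs_neg, abs_of_pos hη0,
        ← Real.rpow_mul hy0.le, show -η * (1 - 2 / η - 1) = 2 by field_simp; ring,
        Real.rpow_sub_one hy0.ne', Real.rpow_ofNat, smul_eq_mul]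
      have : 0 < 1 + θ * y ^ (-η) := by positivity
      field_simp
    · rw [hG, indicator_of_notMem (by simpa using h1), indicator_of_notMem (by simpa using h1)]
      simp
  constructor
  · refine IntegrableOn.congr_fun ?_ (fun y hy => (key y hy).symm) measurableSet_Ioi
    exact ((integrableOn_Ioi_comp_rpow_iff G hp).2 hGi).const_mul _
  · rw [setIntegral_congr_fun measurableSet_Ioi key, integral_const_mul,
      integral_comp_rpow_Ioi G hp, hGI]

/-- The integral over the plane of the interference terms for an interferer whose transmit power
is the power threshold. -/
lemma lintegral_one_sub_interfererLaplace_threshold (hρ : 0 < ρ) (hη : 2 < η) (hθ : 0 < θ) :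
    ∫⁻ x : Plane, (1 - interfererLaplace ρ η (ENNReal.ofReal (θ / ρ)) ρ ‖x‖) =
      ENNReal.ofReal (2 * Real.pi * (θ / η *
        ∫ x in Ioo (0 : ℝ) 1, x ^ ((1 - 2 / η) - 1) * (1 + θ * x)⁻¹)) := by
  set g : ℝ → ℝ := fun y => (Iio 1).indicator (fun x => θ * x / (1 + θ * x)) (y ^ (-η)) with hg
  obtain ⟨hgi, hgI⟩ := setIntegral_interference hη hθ
  have hg0 : ∀ y, 0 ≤ y → 0 ≤ g y := fun y hy =>
    indicator_apply_nonneg fun _ => by have := Real.rpow_nonneg hy (-η); positivity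
  have h1 : ∀ x : Plane, 1 - interfererLaplace ρ η (ENNReal.ofReal (θ / ρ)) ρ ‖x‖ =
      ENNReal.ofReal (g ‖x‖) := by
    intro x
    have hx := Real.rpow_nonneg (norm_nonneg x) (-η)
    have hiff : ρ * ‖x‖ ^ (-η) < ρ ↔ ‖x‖ ^ (-η) < 1 := by
      rw [mul_lt_iff_lt_one_right hρ]
    simp only [interfererLaplace, hg]
    by_cases hc : ‖x‖ ^ (-η) < 1
    · have hpos : 0 < 1 + θ * ‖x‖ ^ (-η) := by positivity
      rw [if_pos (hiff.2 hc), indicator_of_mem (show _ ∈ Iio _ from hc),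
        ← ENNReal.ofReal_mul (by positivity), ← ENNReal.ofReal_one,
        ← ENNReal.ofReal_add zero_le_one (by positivity),
        show θ / ρ * (ρ * ‖x‖ ^ (-η)) = θ * ‖x‖ ^ (-η) by field_simp,
        ← ENNReal.ofReal_inv_of_pos hpos, ← ENNReal.ofReal_sub _ (by positivity)]
      congr 1
      field_simp
      ring
    · rw [if_neg (fun h => hc (hiff.1 h)), indicator_of_notMem (by simpa using hc)]
      simp
  simp_rw [h1]
  -- Polar coordinates: dimension `2` times the unit disc's area `π` gives the factor `2 π`, with
  -- radial weight `y`.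
  have hfin : Module.finrank ℝ Plane = 2 := by simp
  have hint : Integrable (fun x : Plane => g ‖x‖) := by
    rw [integrable_fun_norm_addHaar, hfin]
    simpa [hg] using hgi
  rw [← ofReal_integral_eq_lintegral_ofReal hint (ae_of_all _ fun x => hg0 _ (norm_nonneg x)),
    integral_fun_norm_addHaar, hfin]
  congr 1
  rw [← hgI]
  simp [hg, measureReal_def, mul_assoc, Real.pi_nonneg]

/-- Dependence of the integral over the plane on the distance from the interferer to its serving
base station. -/
lemma lintegral_one_sub_interfererLaplace (hη : 0 < η) (hρ : 0 < ρ) {R : ℝ} (hR : 0 ≤ R) :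
    ∫⁻ x : Plane, (1 - interfererLaplace ρ η s (ρ * R ^ η) ‖x‖) =
      ENNReal.ofReal (R ^ 2) * ∫⁻ x : Plane, (1 - interfererLaplace ρ η s ρ ‖x‖) := by
  rcases hR.eq_or_lt with rfl | hR
  · simp [interfererLaplace, Real.zero_rpow hη.ne', hρ]
  · have hfin : Module.finrank ℝ Plane = 2 := by simp
    -- Dilation by `R` multiplies the path loss by `R ^ (-η)`, cancelling the power `R ^ η`. The
    -- Jacobian of the dilation supplies `R ^ 2`.
    have h1 : ∀ x : Plane, 1 - interfererLaplace ρ η s ρ ‖x‖ =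
        1 - interfererLaplace ρ η s (ρ * R ^ η) ‖R • x‖ := by
      intro x
      have : ρ * R ^ η * ‖R • x‖ ^ (-η) = ρ * ‖x‖ ^ (-η) := by
        rw [norm_smul, Real.norm_of_nonneg hR.le, Real.mul_rpow hR.le (norm_nonneg x),
          Real.rpow_neg hR.le]
        have := Real.rpow_pos_of_pos hR η
        field_simp
      simp only [interfererLaplace, this]
    have hm : Measurable fun x : Plane => 1 - interfererLaplace ρ η s (ρ * R ^ η) ‖x‖ :=
      measurable_const.sub
        (measurable_interfererLaplace.comp (measurable_const.prodMk measurable_norm))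
    simp_rw [h1]
    rw [← lintegral_map hm (measurable_const_smul R), Measure.map_addHaar_smul _ hR.ne', hfin,
      lintegral_smul_measure, smul_eq_mul, ← mul_assoc, ← ENNReal.ofReal_mul (by positivity),
      abs_of_pos (by positivity), mul_inv_cancel₀ (by positivity), ENNReal.ofReal_one, one_mul]

end PlaneIntegral

open Set

namespace Slot

/-! ### Measurability with respect to groups of sources. -/

section Measurability

variable {Ω : Type*} (S : Slot Ω) {m : MeasurableSpace Ω}

/-- The σ-algebra generated by a set of sources of randomness. -/
@[reducible]
def jointSigmaAlgebra (T : Set Source) : MeasurableSpace Ω := ⨆ i ∈ T, S.sigmaAlgebra i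

lemma sigmaAlgebra_le_joint {T : Set Source} {i : Source} (hi : i ∈ T) :
    S.sigmaAlgebra i ≤ S.jointSigmaAlgebra T := le_iSup₂_of_le i hi le_rfl

lemma jointSigmaAlgebra_mono {T T' : Set Source} (h : T ⊆ T') :
    S.jointSigmaAlgebra T ≤ S.jointSigmaAlgebra T' := biSup_mono h

variable {S}

/-- The σ-algebra is arbitrary, so that this also applies to the one generated by the inter-cell
sources alone. -/
lemma measurable_interInterference (hpos : ∀ i, Measurable (S.pos i))
    (hpow : ∀ i, Measurable (S.power i)) (hg : ∀ i, Measurable (S.interGain i)) (ρ η : ℝ) :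
    Measurable (S.interInterference ρ η) := by
  unfold interInterference
  refine Measurable.tsum fun i => Measurable.indicator ?_ (measurableSet_lt ?_ measurable_const)
  · exact (((hpow i).mul (hg i)).mul ((hpos i).norm.pow_const _)).ennreal_ofReal
  · exact (hpow i).mul ((hpos i).norm.pow_const _)

/-- Moves the random number of summands into indicators, so that measurability can be checked term
by term. -/
lemma intraInterference_eq_tsum (ρ : ℝ) (ω : Ω) :
    S.intraInterference ρ ω =
      ∑' n, {ω | n < S.neighbours ω}.indicator
        (fun ω => ENNReal.ofReal (ρ * S.intraGain n ω)) ω := by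
  unfold intraInterference
  rw [tsum_eq_sum (s := Finset.range (S.neighbours ω))]
  · refine Finset.sum_congr rfl fun n hn => ?_
    rw [indicator_of_mem (by simpa using hn)]
  · intro n hn
    rw [indicator_of_notMem (by simpa using hn)]

lemma measurable_intraInterference (hN : Measurable S.neighbours)
    (hg : ∀ i, Measurable (S.intraGain i)) (ρ : ℝ) : Measurable (S.intraInterference ρ) := by
  have : S.intraInterference ρ = fun ω => ∑' n, {ω | n < S.neighbours ω}.indicator
      (fun ω => ENNReal.ofReal (ρ * S.intraGain n ω)) ω :=
    funext (intraInterference_eq_tsum ρ)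
  rw [this]
  refine Measurable.tsum fun i => Measurable.indicator ?_ (measurableSet_lt measurable_const hN)
  exact ((hg i).const_mul ρ).ennreal_ofReal

lemma measurable_pos_joint {T : Set Source} (h : Source.pos ∈ T) (i : ℕ) :
    Measurable[S.jointSigmaAlgebra T] (S.pos i) :=
  (measurable_pi_apply i).comp ((comap_measurable _).mono (S.sigmaAlgebra_le_joint h) le_rfl)

lemma measurable_power_joint {T : Set Source} {i : ℕ} (h : Source.power i ∈ T) :
    Measurable[S.jointSigmaAlgebra T] (S.power i) :=
  (comap_measurable _).mono (S.sigmaAlgebra_le_joint h) le_rfl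

lemma measurable_interGain_joint {T : Set Source} {i : ℕ} (h : Source.interGain i ∈ T) :
    Measurable[S.jointSigmaAlgebra T] (S.interGain i) :=
  (comap_measurable _).mono (S.sigmaAlgebra_le_joint h) le_rfl

lemma measurable_intraGain_joint {T : Set Source} {i : ℕ} (h : Source.intraGain i ∈ T) :
    Measurable[S.jointSigmaAlgebra T] (S.intraGain i) :=
  (comap_measurable _).mono (S.sigmaAlgebra_le_joint h) le_rfl

lemma measurable_neighbours_joint {T : Set Source} (h : Source.neighbours ∈ T) :
    Measurable[S.jointSigmaAlgebra T] S.neighbours :=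
  (comap_measurable _).mono (S.sigmaAlgebra_le_joint h) le_rfl

lemma typicalPower_eq (ρ η : ℝ) (ω : Ω) :
    S.typicalPower ρ η ω = ρ * nearestDist S.bs ω ^ η := rfl

end Measurability

/-! ### Laplace transform of the inter-cell interference. -/

/-- Conditional Laplace transform of the interference of one interferer, given its distance `r`. -/
noncomputable def meanInterfererLaplace {Ω : Type*} [MeasurableSpace Ω] (S : Slot Ω) (μ : Measure Ω)
    (ρ η : ℝ) (s : ℝ≥0∞) (r : ℝ) : ℝ≥0∞ :=
  ∫⁻ ω, interfererLaplace ρ η s (S.typicalPower ρ η ω) r ∂μ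

namespace IsBaseline

variable {Ω : Type*} [mΩ : MeasurableSpace Ω] {μ : Measure Ω} {S : Slot Ω} {lam Ut ρ η : ℝ}

lemma sigmaAlgebra_le (hS : S.IsBaseline μ lam Ut ρ η) (i : Source) : S.sigmaAlgebra i ≤ mΩ := by
  cases i with
  | gain => exact hS.measurable_gain.comap_le
  | pos => exact (measurable_pi_lambda _ hS.pos_law.measurable).comap_le
  | neighbours => exact hS.measurable_neighbours.comap_le
  | power i => exact (hS.measurable_power i).comap_le
  | interGain i => exact (hS.measurable_interGain i).comap_le
  | intraGain i => exact (hS.measurable_intraGain i).comap_le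

lemma jointSigmaAlgebra_le (hS : S.IsBaseline μ lam Ut ρ η) (T : Set Source) :
    S.jointSigmaAlgebra T ≤ mΩ := iSup₂_le fun i _ => hS.sigmaAlgebra_le i

lemma indep_joint (hS : S.IsBaseline μ lam Ut ρ η) {T T' : Set Source} (h : Disjoint T T') :
    Indep (S.jointSigmaAlgebra T) (S.jointSigmaAlgebra T') μ :=
  indep_iSup_of_disjoint hS.sigmaAlgebra_le hS.indep h

lemma indep_joint_single (hS : S.IsBaseline μ lam Ut ρ η) {T : Set Source} {i : Source}
    (h : i ∉ T) : Indep (S.jointSigmaAlgebra T) (S.sigmaAlgebra i) μ :=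
  indep_of_indep_of_le_right (hS.indep_joint (disjoint_singleton_right.2 h))
    (S.sigmaAlgebra_le_joint (mem_singleton i))

lemma measurable_typicalPower (hS : S.IsBaseline μ lam Ut ρ η) :
    Measurable (S.typicalPower ρ η) :=
  ((measurable_nearestDist hS.bs_law.measurable).pow_const η).const_mul ρ

lemma measurable_meanInterfererLaplace [SFinite μ] (hS : S.IsBaseline μ lam Ut ρ η) (s : ℝ≥0∞) :
    Measurable (meanInterfererLaplace S μ ρ η s) := by
  have : Measurable fun q : ℝ × Ω => interfererLaplace ρ η s (S.typicalPower ρ η q.2) q.1 :=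
    measurable_interfererLaplace.comp
      ((hS.measurable_typicalPower.comp measurable_snd).prodMk measurable_fst)
  exact this.lintegral_prod_right'

/-- Integrating out channel gains and transmit powers of finitely many interferers. -/
lemma lintegral_prod_interferers [IsProbabilityMeasure μ] (hS : S.IsBaseline μ lam Ut ρ η)
    {s : ℝ≥0∞} (hs : s ≠ ∞) (n : ℕ) :
    ∫⁻ ω, ∏ i ∈ Finset.range n, expNeg (s * {ω | S.power i ω * ‖S.pos i ω‖ ^ (-η) < ρ}.indicator
        (fun ω => ENNReal.ofReal (S.power i ω * S.interGain i ω * ‖S.pos i ω‖ ^ (-η))) ω) ∂μ =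
      ∫⁻ ω, ∏ i ∈ Finset.range n, meanInterfererLaplace S μ ρ η s ‖S.pos i ω‖ ∂μ := by
  -- channel gains
  let T₁ : ℕ → Set Source := fun k =>
    {i | i = .pos ∨ (∃ j, i = .power j) ∨ ∃ j < k, i = .interGain j}
  let X₁ : Ω → (ℕ → Plane) × (ℕ → ℝ) := fun ω => (fun i => S.pos i ω, fun i => S.power i ω)
  let F₁ : ℕ → (ℕ → Plane) × (ℕ → ℝ) → ℝ → ℝ≥0∞ := fun i x h =>
    if x.2 i * ‖x.1 i‖ ^ (-η) < ρ then
      expNeg (s * ENNReal.ofReal (x.2 i * h * ‖x.1 i‖ ^ (-η))) else 1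
  have hF₁ : ∀ k, Measurable (Function.uncurry (F₁ k)) := fun k => by
    have h1 : Measurable fun q : ((ℕ → Plane) × (ℕ → ℝ)) × ℝ => q.1.2 k :=
      (measurable_pi_apply k).comp (measurable_snd.comp measurable_fst)
    have h2 : Measurable fun q : ((ℕ → Plane) × (ℕ → ℝ)) × ℝ => ‖q.1.1 k‖ ^ (-η) :=
      (((measurable_pi_apply k).comp (measurable_fst.comp measurable_fst)).norm).pow_const _
    refine Measurable.ite (measurableSet_lt (h1.mul h2) measurable_const) ?_ measurable_const
    exact measurable_expNeg.comp
      ((((h1.mul measurable_snd).mul h2).ennreal_ofReal).const_mul s)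
  have hX₁ : Measurable[S.jointSigmaAlgebra (T₁ 0)] X₁ :=
    (@measurable_pi_lambda _ _ _ (S.jointSigmaAlgebra (T₁ 0)) _ _
      fun i => measurable_pos_joint (Or.inl rfl) i).prodMk
    (@measurable_pi_lambda _ _ _ (S.jointSigmaAlgebra (T₁ 0)) _ _
      fun i => measurable_power_joint (Or.inr (Or.inl ⟨i, rfl⟩)))
  have hmono₁ : Monotone fun k => S.jointSigmaAlgebra (T₁ k) := fun k l hkl =>
    S.jointSigmaAlgebra_mono fun i hi => by
      rcases hi with h | h | ⟨j, hj, h⟩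
      exacts [Or.inl h, Or.inr (Or.inl h), Or.inr (Or.inr ⟨j, hj.trans_le hkl, h⟩)]
  -- Positions and all powers lie in the initial σ-algebra. Each gain is independent of these
  -- together with the earlier gains.
  have step₁ := lintegral_mul_prod_of_indep (μ := μ) (m := fun k => S.jointSigmaAlgebra (T₁ k))
    (fun k => hS.jointSigmaAlgebra_le _) hmono₁ hX₁ hS.measurable_interGain
    (fun k => measurable_interGain_joint (Or.inr (Or.inr ⟨k, Nat.lt_succ_self k, rfl⟩)))
    (fun k => hS.indep_joint_single (i := .interGain k) (by simp [T₁])) hF₁ n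
    (K := fun _ => 1) measurable_const
  have law₁ : ∀ (i : ℕ) (x : (ℕ → Plane) × (ℕ → ℝ)), ∫⁻ y, F₁ i x y ∂(μ.map (S.interGain i)) =
      interfererLaplace ρ η s (x.2 i) ‖x.1 i‖ := fun i x => by
    rw [(hS.interGain_law i).map_eq]
    have := isProbabilityMeasure_expMeasure one_pos
    simp only [F₁, interfererLaplace]
    split_ifs with hc
    · rw [← lintegral_expNeg_expMeasure (ENNReal.mul_ne_top hs ENNReal.ofReal_ne_top)]
      -- `ENNReal.ofReal` is multiplicative once one factor is nonnegative. The power carries no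
      -- sign assumption, so the almost surely positive gain serves.
      have hae : ∀ᵐ y ∂(expMeasure 1), 0 < y := by
        have := expMeasure_Iic_zero
        rw [measure_eq_zero_iff_ae_notMem] at this
        simpa using this
      refine lintegral_congr_ae ?_
      filter_upwards [hae] with y hy
      rw [mul_right_comm (x.2 i), ENNReal.ofReal_mul' hy.le, mul_assoc]
    · simp
  -- transmit powers
  let T₂ : ℕ → Set Source := fun k => {i | i = .pos ∨ ∃ j < k, i = .power j}
  let X₂ : Ω → ℕ → Plane := fun ω i => S.pos i ω
  let F₂ : ℕ → (ℕ → Plane) → ℝ → ℝ≥0∞ := fun i x p => interfererLaplace ρ η s p ‖x i‖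
  have hF₂ : ∀ k, Measurable (Function.uncurry (F₂ k)) := fun k =>
    measurable_interfererLaplace.comp
      (measurable_snd.prodMk ((measurable_pi_apply k).comp measurable_fst).norm)
  have hX₂ : Measurable[S.jointSigmaAlgebra (T₂ 0)] X₂ :=
    @measurable_pi_lambda _ _ _ (S.jointSigmaAlgebra (T₂ 0)) _ _
      fun i => measurable_pos_joint (Or.inl rfl) i
  have hmono₂ : Monotone fun k => S.jointSigmaAlgebra (T₂ k) := fun k l hkl =>
    S.jointSigmaAlgebra_mono fun i hi => by
      rcases hi with h | ⟨j, hj, h⟩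
      exacts [Or.inl h, Or.inr ⟨j, hj.trans_le hkl, h⟩]
  have step₂ := lintegral_mul_prod_of_indep (μ := μ) (m := fun k => S.jointSigmaAlgebra (T₂ k))
    (fun k => hS.jointSigmaAlgebra_le _) hmono₂ hX₂ hS.measurable_power
    (fun k => measurable_power_joint (Or.inr ⟨k, Nat.lt_succ_self k, rfl⟩))
    (fun k => hS.indep_joint_single (i := .power k) (by simp [T₂])) hF₂ n
    (K := fun _ => 1) measurable_const
  have law₂ : ∀ (i : ℕ) (x : ℕ → Plane), ∫⁻ p, F₂ i x p ∂(μ.map (S.power i)) =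
      meanInterfererLaplace S μ ρ η s ‖x i‖ := fun i x => by
    have hm : Measurable (F₂ i x) := (hF₂ i).comp (measurable_const.prodMk measurable_id)
    rw [(hS.power_law i).map_eq, lintegral_map hm hS.measurable_typicalPower]
    rfl
  simp only [one_mul, law₁] at step₁
  simp only [one_mul, law₂] at step₂
  have hF : ∀ i ω, expNeg (s * {ω | S.power i ω * ‖S.pos i ω‖ ^ (-η) < ρ}.indicator
      (fun ω => ENNReal.ofReal (S.power i ω * S.interGain i ω * ‖S.pos i ω‖ ^ (-η))) ω) =
      F₁ i (X₁ ω) (S.interGain i ω) := fun i ω => by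
    simp only [F₁, X₁, indicator_apply, mem_ofPred_eq]
    split_ifs <;> simp
  simp_rw [hF]
  exact step₁.trans step₂

/-- Integral over the plane of the mean interference terms, by averaging over the distance from an
interferer to its serving base station. -/
lemma lintegral_one_sub_meanInterfererLaplace [IsProbabilityMeasure μ]
    (hS : S.IsBaseline μ lam Ut ρ η) (hlam : 0 < lam) (hρ : 0 < ρ) (hη : 0 < η) (s : ℝ≥0∞) :
    ∫⁻ x : Plane, (1 - meanInterfererLaplace S μ ρ η s ‖x‖) =
      ENNReal.ofReal ((lam * Real.pi)⁻¹) *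
        ∫⁻ x : Plane, (1 - interfererLaplace ρ η s ρ ‖x‖) := by
  have hm : Measurable fun q : Plane × Ω => interfererLaplace ρ η s (S.typicalPower ρ η q.2) ‖q.1‖ :=
    measurable_interfererLaplace.comp
      ((hS.measurable_typicalPower.comp measurable_snd).prodMk measurable_fst.norm)
  have h1 : ∀ x : Plane, 1 - meanInterfererLaplace S μ ρ η s ‖x‖ =
      ∫⁻ ω, (1 - interfererLaplace ρ η s (S.typicalPower ρ η ω) ‖x‖) ∂μ := fun x => by
    have hx : Measurable fun ω => interfererLaplace ρ η s (S.typicalPower ρ η ω) ‖x‖ :=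
      measurable_interfererLaplace.comp (hS.measurable_typicalPower.prodMk measurable_const)
    rw [lintegral_sub hx
      ((lintegral_mono fun ω => interfererLaplace_le_one _ _).trans_lt (by simp)).ne
      (ae_of_all _ fun ω => interfererLaplace_le_one _ _)]
    simp [meanInterfererLaplace]
  simp_rw [h1]
  -- After Tonelli the serving distance is fixed inside the plane integral, so scaling pulls out its
  -- square and only the mean square remains.
  rw [lintegral_lintegral_swap (measurable_const.sub hm).aemeasurable]
  simp_rw [typicalPower_eq, lintegral_one_sub_interfererLaplace hη hρ (nearestDist_nonneg S.bs _)]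
  rw [lintegral_mul_const _
    ((measurable_nearestDist hS.bs_law.measurable).pow_const 2).ennreal_ofReal,
    hS.bs_law.lintegral_nearestDist_sq hlam]

/-- Laplace transform of the inter-cell interference. -/
lemma lintegral_expNeg_interInterference [IsProbabilityMeasure μ]
    (hS : S.IsBaseline μ lam Ut ρ η) (hlam : 0 < lam) (hρ : 0 < ρ) (hη : 0 < η)
    {s : ℝ≥0∞} (hs : s ≠ ∞) :
    ∫⁻ ω, expNeg (s * S.interInterference ρ η ω) ∂μ =
      expNeg (ENNReal.ofReal Ut * (ENNReal.ofReal ((lam * Real.pi)⁻¹) *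
        ∫⁻ x : Plane, (1 - interfererLaplace ρ η s ρ ‖x‖))) := by
  have hσ : SigmaFinite (ENNReal.ofReal Ut • (volume : Measure Plane)) :=
    inferInstanceAs (SigmaFinite (Ut.toNNReal • (volume : Measure Plane)))
  have hpos := hS.pos_law.measurable
  have hφ := hS.measurable_meanInterfererLaplace s
  have hφ1 : ∀ r, meanInterfererLaplace S μ ρ η s r ≤ 1 := fun r =>
    (lintegral_mono fun ω => interfererLaplace_le_one _ _).trans (by simp)
  have hanti : ∀ f : ℕ → ℝ≥0∞, (∀ i, f i ≤ 1) → Antitone fun n => ∏ i ∈ Finset.range n, f i :=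
    fun f hf => antitone_nat_of_succ_le fun n => by
      rw [Finset.prod_range_succ]
      exact mul_le_of_le_one_right zero_le (hf n)
  have hG := hS.pos_law.lintegral_iInf_prod (φ := fun x => meanInterfererLaplace S μ ρ η s ‖x‖)
    (hφ.comp measurable_norm) (fun x => hφ1 _)
  rw [lintegral_smul_measure, smul_eq_mul,
    hS.lintegral_one_sub_meanInterfererLaplace hlam hρ hη] at hG
  rw [← hG]
  unfold interInterference
  simp_rw [← ENNReal.tsum_mul_left, expNeg_tsum]
  -- The partial products decrease and start from the empty product `1`, which is integrable, so
  -- limit and expectation commute on both sides.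
  rw [lintegral_iInf, lintegral_iInf]
  · exact iInf_congr fun n => hS.lintegral_prod_interferers hs n
  · exact fun n => Finset.measurable_fun_prod _ fun i _ => hφ.comp (hpos i).norm
  · exact fun k l hkl ω => hanti _ (fun i => hφ1 _) hkl
  · simp
  · refine fun n => Finset.measurable_fun_prod _ fun i _ => ?_
    have h1 := hS.measurable_power i
    have h2 := (hpos i).norm.pow_const (-η)
    have h3 := hS.measurable_interGain i
    exact measurable_expNeg.comp ((((h1.mul h3).mul h2).ennreal_ofReal.indicator
      (measurableSet_lt (h1.mul h2) measurable_const)).const_mul s)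
  · exact fun k l hkl ω => hanti _ (fun i => expNeg_le_one _) hkl
  · simp

end IsBaseline

end Slot

open Set

/-! ### Laplace transform of the intra-cell interference. -/

/-- Probability generating function of the number of intra-cell interferers. -/
lemma lintegral_pow_neighbourLaw {lam Ut y : ℝ} (hlam : 0 < lam) (hUt : 0 ≤ Ut) (hy0 : 0 ≤ y)
    (hy1 : y ≤ 1) :
    ∫⁻ n, ENNReal.ofReal y ^ n ∂(neighbourLaw lam Ut) =
      ENNReal.ofReal ((voronoiShape * lam / (voronoiShape * lam + Ut * (1 - y))) ^ voronoiShape) := by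
  have hc : 0 < voronoiShape := by norm_num [voronoiShape]
  unfold neighbourLaw cellAreaLaw
  rw [Measure.lintegral_bind (Kernel.aemeasurable _) (by fun_prop),
    ← lintegral_expNeg_gammaMeasure hc (mul_pos hc hlam) (mul_nonneg hUt (sub_nonneg.2 hy1))]
  refine lintegral_congr fun a => ?_
  change ∫⁻ n, ENNReal.ofReal y ^ n ∂(poissonMeasure (Ut * a).toNNReal) = _
  rw [lintegral_countable']
  simp_rw [mul_comm _ (poissonMeasure _ _)]
  rw [tsum_poissonMeasure_mul_pow _ (by simpa using hy1), ENNReal.ofReal_mul hUt,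
    ← ENNReal.ofReal_one, ← ENNReal.ofReal_sub _ hy0]
  congr 1
  change _ * ENNReal.ofReal (Ut * a) = _
  rw [ENNReal.ofReal_mul hUt]
  ring

namespace Slot

namespace IsBaseline

variable {Ω : Type*} [mΩ : MeasurableSpace Ω] {μ : Measure Ω} {S : Slot Ω} {lam Ut ρ η : ℝ}

/-- Laplace transform of the intra-cell interference. -/
lemma lintegral_expNeg_intraInterference [IsProbabilityMeasure μ]
    (hS : S.IsBaseline μ lam Ut ρ η) (hlam : 0 < lam) (hUt : 0 ≤ Ut) (hρ : 0 < ρ) {θ : ℝ}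
    (hθ : 0 < θ) :
    ∫⁻ ω, expNeg (ENNReal.ofReal (θ / ρ) * S.intraInterference ρ ω) ∂μ =
      ENNReal.ofReal ((voronoiShape * lam / (voronoiShape * lam + Ut * (1 - (1 + θ)⁻¹))) ^
        voronoiShape) := by
  have hθ1 : 0 < 1 + θ := by linarith
  have hNm := hS.measurable_neighbours
  have hgm := hS.measurable_intraGain
  let E : ℕ → Set Ω := fun k => S.neighbours ⁻¹' {k}
  have hEm : ∀ k, MeasurableSet (E k) := fun k => hNm (measurableSet_singleton k)
  have hmul : ∀ x : ℝ, ENNReal.ofReal (θ / ρ) * ENNReal.ofReal (ρ * x) =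
      ENNReal.ofReal θ * ENNReal.ofReal x := fun x => by
    rw [← ENNReal.ofReal_mul (by positivity), ← ENNReal.ofReal_mul hθ.le]
    congr 1
    field_simp
  -- Splitting by the value of the number of interferers makes the number of factors deterministic
  -- in each term.
  have hdec : ∀ ω, expNeg (ENNReal.ofReal (θ / ρ) * S.intraInterference ρ ω) =
      ∑' k, (E k).indicator 1 ω *
        ∏ n ∈ Finset.range k, expNeg (ENNReal.ofReal θ * ENNReal.ofReal (S.intraGain n ω)) := by
    intro ω
    rw [tsum_eq_single (S.neighbours ω), indicator_of_mem (by simp [E]), Pi.one_apply, one_mul,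
      intraInterference, Finset.mul_sum, expNeg_sum]
    · simp_rw [hmul]
    · intro k hk
      rw [indicator_of_notMem (by simpa [E] using hk.symm), zero_mul]
  let T : ℕ → Set Source := fun k => {i | i = .neighbours ∨ ∃ j < k, i = .intraGain j}
  have hmono : Monotone fun k => S.jointSigmaAlgebra (T k) := fun k l hkl =>
    S.jointSigmaAlgebra_mono fun i hi => by
      rcases hi with h | ⟨j, hj, h⟩
      exacts [Or.inl h, Or.inr ⟨j, hj.trans_le hkl, h⟩]
  -- The factors share no common variable, hence the trivial `Unit` parameter; the count enters
  -- through the indicator in the role of `K`.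
  let F : ℕ → Unit → ℝ → ℝ≥0∞ := fun _ _ x => expNeg (ENNReal.ofReal θ * ENNReal.ofReal x)
  have hterm : ∀ k, ∫⁻ ω, (E k).indicator 1 ω *
      ∏ n ∈ Finset.range k, expNeg (ENNReal.ofReal θ * ENNReal.ofReal (S.intraGain n ω)) ∂μ =
      ENNReal.ofReal (1 + θ)⁻¹ ^ k * neighbourLaw lam Ut {k} := by
    intro k
    have hK : Measurable[S.jointSigmaAlgebra (T 0)] ((E k).indicator (1 : Ω → ℝ≥0∞)) :=
      (measurable_of_countable (({k} : Set ℕ).indicator (1 : ℕ → ℝ≥0∞))).comp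
        (measurable_neighbours_joint (Or.inl rfl))
    have step := lintegral_mul_prod_of_indep (μ := μ) (m := fun k => S.jointSigmaAlgebra (T k))
      (fun k => hS.jointSigmaAlgebra_le _) hmono (X := fun _ => ()) measurable_const hgm
      (fun k => measurable_intraGain_joint (Or.inr ⟨k, Nat.lt_succ_self k, rfl⟩))
      (fun k => hS.indep_joint_single (i := .intraGain k) (by simp [T]))
      (F := F) (fun k => by fun_prop) k hK
    have law : ∀ i, ∫⁻ y, F i () y ∂(μ.map (S.intraGain i)) = ENNReal.ofReal (1 + θ)⁻¹ := fun i => by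
      rw [(hS.intraGain_law i).map_eq, ENNReal.ofReal_inv_of_pos hθ1,
        ENNReal.ofReal_add zero_le_one hθ.le, ENNReal.ofReal_one]
      exact lintegral_expNeg_expMeasure ENNReal.ofReal_ne_top
    simp only [law, Finset.prod_const, Finset.card_range] at step
    refine step.trans ?_
    rw [lintegral_mul_const _ (measurable_one.indicator (hEm k)), lintegral_indicator_one (hEm k),
      mul_comm, ← hS.neighbours_law.map_eq, Measure.map_apply hNm (measurableSet_singleton k)]
  simp_rw [hdec]
  rw [lintegral_tsum]
  · simp_rw [hterm]
    rw [← lintegral_countable', lintegral_pow_neighbourLaw hlam hUt (by positivity)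
      (inv_le_one_of_one_le₀ (by linarith))]
  · intro k
    refine ((measurable_one.indicator (hEm k)).mul ?_).aemeasurable
    exact Finset.measurable_fun_prod _ fun n _ => by have := hgm n; fun_prop

/-! ### From the SINR event to the closed formula. -/

/-- Probability of success given by the Laplace transform of noise plus interference. -/
lemma measure_le_gain [IsProbabilityMeasure μ] (hS : S.IsBaseline μ lam Ut ρ η) (s a : ℝ≥0∞) :
    μ {ω | s * (a + S.intraInterference ρ ω + S.interInterference ρ η ω) ≤
        ENNReal.ofReal (S.gain ω)} =
      expNeg (s * a) * (∫⁻ ω, expNeg (s * S.intraInterference ρ ω) ∂μ) *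
        ∫⁻ ω, expNeg (s * S.interInterference ρ η ω) ∂μ := by
  let T₁ : Set Source := {i | i = .neighbours ∨ ∃ j, i = .intraGain j}
  let T₂ : Set Source := {i | i = .pos ∨ (∃ j, i = .power j) ∨ ∃ j, i = .interGain j}
  have hdisj : Disjoint T₁ T₂ := by
    refine Set.disjoint_left.2 ?_
    rintro i (rfl | ⟨j, rfl⟩) (h | ⟨k, h⟩ | ⟨k, h⟩) <;> cases h
  have hintra : ∀ T ⊇ T₁, Measurable[S.jointSigmaAlgebra T] (S.intraInterference ρ) := fun T hT =>
    measurable_intraInterference (measurable_neighbours_joint (hT (Or.inl rfl)))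
      (fun i => measurable_intraGain_joint (hT (Or.inr ⟨i, rfl⟩))) ρ
  have hinter : ∀ T ⊇ T₂, Measurable[S.jointSigmaAlgebra T] (S.interInterference ρ η) := fun T hT =>
    measurable_interInterference (fun i => measurable_pos_joint (hT (Or.inl rfl)) i)
      (fun i => measurable_power_joint (hT (Or.inr (Or.inl ⟨i, rfl⟩))))
      (fun i => measurable_interGain_joint (hT (Or.inr (Or.inr ⟨i, rfl⟩)))) ρ η
  let D : Ω → ℝ≥0∞ := fun ω => s * (a + S.intraInterference ρ ω + S.interInterference ρ η ω)
  have hD : Measurable[S.jointSigmaAlgebra (T₁ ∪ T₂)] D :=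
    ((measurable_const.add (hintra _ subset_union_left)).add
      (hinter _ subset_union_right)).const_mul s
  have hD' : Measurable D := hD.mono (hS.jointSigmaAlgebra_le _) le_rfl
  let F : ℝ≥0∞ → ℝ → ℝ≥0∞ := fun d h => {q : ℝ≥0∞ × ℝ | q.1 ≤ ENNReal.ofReal q.2}.indicator 1 (d, h)
  have hFs : MeasurableSet {q : ℝ≥0∞ × ℝ | q.1 ≤ ENNReal.ofReal q.2} :=
    measurableSet_le measurable_fst measurable_snd.ennreal_ofReal
  have hF : Measurable (Function.uncurry F) := measurable_one.indicator hFs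
  -- The test gain belongs to neither group of sources, so it can be integrated out first; its
  -- exponential tail turns the event into `exp (-D)`.
  have step := lintegral_mul_comp_of_indep (μ := μ) (hS.jointSigmaAlgebra_le (T₁ ∪ T₂))
    (K := fun _ => 1) measurable_const hD hS.measurable_gain
    (hS.indep_joint_single (i := .gain) (by simp [T₁, T₂])) hF
  have law : ∀ d, ∫⁻ h, F d h ∂(μ.map S.gain) = expNeg d := fun d => by
    rw [hS.gain_law.map_eq, ← expMeasure_setOf_le_ofReal d,
      ← lintegral_indicator_one (measurableSet_le measurable_const ENNReal.measurable_ofReal)]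
    rfl
  have hset : MeasurableSet {ω | D ω ≤ ENNReal.ofReal (S.gain ω)} :=
    measurableSet_le hD' hS.measurable_gain.ennreal_ofReal
  simp only [one_mul, law] at step
  have hfac : ∀ ω, expNeg (D ω) = expNeg (s * a) * (expNeg (s * S.intraInterference ρ ω) *
      expNeg (s * S.interInterference ρ η ω)) := fun ω => by
    simp only [D, mul_add, expNeg_add, mul_assoc]
  have hm1 : Measurable[S.jointSigmaAlgebra T₁] fun ω => expNeg (s * S.intraInterference ρ ω) :=
    measurable_expNeg.comp ((hintra T₁ subset_rfl).const_mul s)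
  have hm2 : Measurable[S.jointSigmaAlgebra T₂] fun ω => expNeg (s * S.interInterference ρ η ω) :=
    measurable_expNeg.comp ((hinter T₂ subset_rfl).const_mul s)
  calc μ {ω | D ω ≤ ENNReal.ofReal (S.gain ω)} = ∫⁻ ω, F (D ω) (S.gain ω) ∂μ := by
        rw [← lintegral_indicator_one hset]
        rfl
    _ = _ := by
        rw [step]
        simp_rw [hfac]
        rw [lintegral_const_mul' _ _ (expNeg_ne_top _), mul_assoc,
          lintegral_mul_eq_lintegral_mul_lintegral_of_independent_measurableSpace
            (hS.jointSigmaAlgebra_le T₁) (hS.jointSigmaAlgebra_le T₂) (hS.indep_joint hdisj)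
            hm1 hm2]

/-- The transmission fails unless the channel gain exceeds the scaled noise plus interference. -/
lemma failureProbability_eq [IsProbabilityMeasure μ] (hS : S.IsBaseline μ lam Ut ρ η)
    (hρ : 0 < ρ) {θ : ℝ} (hθ : 0 < θ) (σsq : ℝ) :
    S.failureProbability μ ρ η σsq θ =
      1 - μ.real {ω | ENNReal.ofReal (θ / ρ) * (ENNReal.ofReal σsq + S.intraInterference ρ ω +
        S.interInterference ρ η ω) ≤ ENNReal.ofReal (S.gain ω)} := by
  have hpos : ∀ᵐ ω ∂μ, 0 < S.gain ω := by
    have h1 : μ (S.gain ⁻¹' Iic 0) = 0 := by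
      rw [← Measure.map_apply hS.measurable_gain measurableSet_Iic, hS.gain_law.map_eq,
        expMeasure_Iic_zero]
    rw [measure_eq_zero_iff_ae_notMem] at h1
    simpa using h1
  have hD : Measurable fun ω => ENNReal.ofReal (θ / ρ) * (ENNReal.ofReal σsq +
      S.intraInterference ρ ω + S.interInterference ρ η ω) :=
    ((measurable_const.add (measurable_intraInterference hS.measurable_neighbours
      hS.measurable_intraGain ρ)).add (measurable_interInterference hS.pos_law.measurable
      hS.measurable_power hS.measurable_interGain ρ η)).const_mul _
  rw [← probReal_compl_eq_one_sub (measurableSet_le hD hS.measurable_gain.ennreal_ofReal)]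
  unfold failureProbability
  refine measureReal_congr ?_
  filter_upwards [hpos] with ω hω
  refine propext (not_iff_not.1 ?_)
  change ¬ (S.sinr ρ η σsq ω < ENNReal.ofReal θ) ↔ ¬¬ ((_ : ℝ≥0∞) ≤ _)
  -- A nonzero numerator rules out `0 / 0`: with zero noise and interference the SINR is `∞` and the
  -- transmission succeeds.
  have hg0 : ENNReal.ofReal (ρ * S.gain ω) ≠ 0 := by
    rw [Ne, ENNReal.ofReal_eq_zero, not_le]
    positivity
  rw [not_not, not_lt, sinr, ENNReal.le_div_iff_mul_le (Or.inr hg0) (Or.inr ENNReal.ofReal_ne_top),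
    show θ = ρ * (θ / ρ) by field_simp, ENNReal.ofReal_mul hρ.le, ENNReal.ofReal_mul hρ.le, mul_assoc,
    mul_div_cancel_left₀ _ hρ.ne']
  exact ENNReal.mul_le_mul_iff_right (by simpa using hρ) ENNReal.ofReal_ne_top

/-- Transmission failure probability, with the inter-cell interference in hypergeometric form. -/
theorem failureProbability_eq_gaussHypergeometric [IsProbabilityMeasure μ]
    (hS : S.IsBaseline μ lam Ut ρ η) (hlam : 0 < lam) (hUt : 0 < Ut) (hρ : 0 < ρ) (hη : 2 < η)
    {σsq θ : ℝ} (hσ : 0 ≤ σsq) (hθ : 0 < θ) :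
    S.failureProbability μ ρ η σsq θ =
      1 - (voronoiShape * lam / (voronoiShape * lam + Ut * (1 - (1 + θ)⁻¹))) ^ voronoiShape *
        Real.exp (-(σsq * θ / ρ) - 2 * θ * Ut / ((η - 2) * lam) *
          gaussHypergeometric 1 (1 - 2 / η) (2 - 2 / η) (-θ)) := by
  have hη0 : 0 < η := by linarith
  have hη2 : 0 < η - 2 := by linarith
  have hb : 0 < 1 - 2 / η := by rw [sub_pos, div_lt_one hη0]; exact hη
  have hc : 0 < voronoiShape := by norm_num [voronoiShape]
  have hz : 0 ≤ 1 - (1 + θ)⁻¹ := sub_nonneg.2 (inv_le_one_of_one_le₀ (by linarith))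
  have hF := gaussHypergeometric_eq_integral hb hθ
  rw [show 1 - 2 / η + 1 = 2 - 2 / η by ring] at hF
  set I := ∫ x in Ioo (0 : ℝ) 1, x ^ ((1 - 2 / η) - 1) * (1 + θ * x)⁻¹ with hI
  have hI0 : 0 ≤ I := setIntegral_nonneg measurableSet_Ioo fun x hx => by
    have := hx.1
    positivity
  rw [hS.failureProbability_eq hρ hθ, measureReal_def, hS.measure_le_gain,
    hS.lintegral_expNeg_intraInterference hlam hUt.le hρ hθ,
    hS.lintegral_expNeg_interInterference hlam hρ hη0 ENNReal.ofReal_ne_top,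
    lintegral_one_sub_interfererLaplace_threshold hρ hη hθ, ← hI, ← ENNReal.ofReal_mul (by positivity),
    ← ENNReal.ofReal_mul (by positivity), ← ENNReal.ofReal_mul (by positivity),
    expNeg_ofReal (by positivity), expNeg_ofReal (by positivity), ENNReal.toReal_mul,
    ENNReal.toReal_mul, ENNReal.toReal_ofReal (by positivity), ENNReal.toReal_ofReal (by positivity),
    ENNReal.toReal_ofReal (by positivity), mul_comm (Real.exp _), mul_assoc, ← Real.exp_add, hF]
  congr 3
  -- The `π` of polar coordinates cancels that of the mean squared distance. Since `1 - 2 / η = (η -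
  -- 2) / η`, Euler's prefactor turns `1 / η` into `1 / (η - 2)`.
  have := Real.pi_ne_zero
  field_simp
  ring

end IsBaseline

end Slot

end RACH

/-! ### The theorem in terms of `P`, and the case `η = 4`. -/

/-- Transmission failure probability of the random access channel in the baseline scheme. -/
theorem theorem1 {Ω : Type*} [MeasurableSpace Ω] (μ : Measure Ω) [IsProbabilityMeasure μ]
    (lam U ρ η σsq θ : ℝ) (nZ : ℕ)
    (hlam : 0 < lam) (hU : 0 < U) (hnZ : 0 < nZ) (hρ : 0 < ρ) (hη : 2 < η)
    (hσ : 0 ≤ σsq) (hθ : 0 < θ)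
    (Ut c P : ℝ) (hUt : Ut = RACH.sequenceIntensity 1 U nZ)
    (hc : c = RACH.voronoiShape) (hP : P = c * lam / (c * lam + Ut))
    (S : RACH.Slot Ω) (hS : S.IsBaseline μ lam Ut ρ η) :
    S.failureProbability μ ρ η σsq θ =
        1 - (P * (1 + θ) / (P + θ)) ^ c *
          Real.exp (-(σsq * θ / ρ) - 2 * θ * Ut / ((η - 2) * lam) *
            RACH.gaussHypergeometric 1 (1 - 2 / η) (2 - 2 / η) (-θ)) ∧
    (η = 4 →
      θ * RACH.gaussHypergeometric 1 (1 - 2 / η) (2 - 2 / η) (-θ) =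
          √θ * Real.arctan √θ ∧
      S.failureProbability μ ρ η σsq θ =
        1 - (P * (1 + θ) / (P + θ)) ^ c *
          Real.exp (-(σsq * θ / ρ) - Ut * √θ * Real.arctan √θ / lam)) := by
  have hUt0 : 0 < Ut := by
    have : (0 : ℝ) < nZ := by exact_mod_cast hnZ
    rw [hUt, RACH.sequenceIntensity]
    positivity
  have hc0 : 0 < c := by rw [hc]; norm_num [RACH.voronoiShape]
  -- Divide numerator and denominator by `c * lam + Ut`: the ratio is `P (1 + θ) / (P (1 + θ) + (1 -
  -- P) θ)`, and that denominator is `P + θ`.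
  have hbase : c * lam / (c * lam + Ut * (1 - (1 + θ)⁻¹)) = P * (1 + θ) / (P + θ) := by
    have h1 : 1 - (1 + θ)⁻¹ = θ / (1 + θ) := by field_simp; ring
    rw [h1, hP]
    field_simp
    ring
  have hmain := hS.failureProbability_eq_gaussHypergeometric hlam hUt0 hρ hη hσ hθ
  rw [← hc, hbase] at hmain
  refine ⟨hmain, fun h4 => ?_⟩
  have hF : θ * RACH.gaussHypergeometric 1 (1 - 2 / η) (2 - 2 / η) (-θ) =
      √θ * Real.arctan √θ := by
    rw [h4, show (1 : ℝ) - 2 / 4 = 1 / 2 by norm_num, show (2 : ℝ) - 2 / 4 = 3 / 2 by norm_num]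
    exact RACH.mul_gaussHypergeometric_half hθ
  refine ⟨hF, ?_⟩
  rw [hmain]
  congr 3
  rw [mul_assoc Ut, ← hF, h4]
  field_simp
  ring
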